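/- Let $I\subset\mathbb R$ be an open interval and let $\alpha:I\to S^3\subset\mathbb R^4$ be a $C^4$ curve (with any regular parameter) on the unit sphere centred at the origin whose derivatives $\alpha',\alpha'',\alpha'''$ are linearly independent at every point. Let $e_1,e_2,e_3$ be obtained from $\alpha',\alpha'',\alpha'''$ by the Gram–Schmidt process, let $e_4$ complete them to a positively oriented orthonormal basis of $\mathbb R^4$, and let $k_i=\langle e_i',e_{i+1}\rangle/\|\alpha'\|$, $i=1,2,3$, be the curvatures of $\alpha$ in $\mathbb R^4$. Suppose that 1. $k_3$ vanishes nowhere on $I$ (the curve is genuinely $4$-dimensional); 2. $\alpha$ has constant curvature ratios: $k_2/k_1$ and $k_3/k_2$ are constant on $I$; 3. $\alpha$ is a general helix of $S^3$ in the sense of Barros: there is a Killing vector field $V$ along $\alpha$ which has constant non-zero length and makes a constant angle with $\alpha'$. Then $k_1$, $k_2$ and $k_3$ are constant on $I$. Here, for a curve in $S^3$ with speed $v$ and unit tangent $t$, the intrinsic curvature $\kappa$ and torsion $\tau$ are those of the Frenet equations $\nabla_t t=\kappa n$, $\nabla_t n=-\kappa t+\tau b$, $\nabla_t b=-\tau n$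 for the Levi-Civita connection $\nabla$ of $S^3$ ($\tau$ being defined where $\kappa\neq0$). A vector field $V$ along $\alpha$ is called a Killing vector field along $\alpha$ if there is a $C^4$ variation $\Gamma:(-\varepsilon,\varepsilon)\times I\to S^3$ of $\alpha=\Gamma(0,\cdot)$ with $\frac{\partial\Gamma}{\partial t}(0,\cdot)=V$ for which the $t$-derivatives at $t=0$ of $v$, $\kappa^2$ and, where $\kappa\ne0$ on $\alpha$, $\tau^2$ all vanish. (The restriction to $\alpha$ of any Killing field of $S^3$ has this property.) -/

import Mathlib

noncomputable section

/-- Euclidean four-space. -/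
abbrev E4 : Type := EuclideanSpace ℝ (Fin 4)

/-- The determinant of four vectors of `ℝ⁴`. -/
def det4 (u v w x : E4) : ℝ :=
  Matrix.det (Matrix.of ![u.ofLp, v.ofLp, w.ofLp, x.ofLp])

/-- The triple vector product of `ℝ⁴`: the vector `c` with `⟪c, x⟫ = det (u, v, w, x)`. -/
def cross3 (u v w : E4) : E4 :=
  WithLp.toLp 2 (fun i => det4 u v w (EuclideanSpace.single i 1))

/-! ### Extrinsic Frenet apparatus of a curve in `ℝ⁴` -/

/-- `α` is a curve of class `C⁴` on `I` whose first three derivatives are linearly independent at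
every point, so that its Frenet frame and its curvatures exist. -/
structure IsFrenetCurve (I : Set ℝ) (α : ℝ → E4) : Prop where
  contDiffOn : ContDiffOn ℝ 4 α I
  linearIndependent : ∀ s ∈ I, LinearIndependent ℝ (fun j : Fin 3 => iteratedDeriv (j + 1) α s)

/-- The orthonormal vectors obtained from `α', α'', α''', …` by the Gram-Schmidt process. -/
def gsFrame (α : ℝ → E4) (s : ℝ) (j : ℕ) : E4 :=
  InnerProductSpace.gramSchmidtNormed ℝ (fun i : ℕ => iteratedDeriv (i + 1) α s) j

/-- The Frenet frame `e₁, e₂, e₃, e₄` (indexed by `0, 1, 2, 3`): the first three vectors come from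
the Gram-Schmidt process, the last one completes them to a positive orthonormal basis. -/
def frenetFrame (α : ℝ → E4) (s : ℝ) : Fin 4 → E4 :=
  ![gsFrame α s 0, gsFrame α s 1, gsFrame α s 2,
    cross3 (gsFrame α s 0) (gsFrame α s 1) (gsFrame α s 2)]

/-- The curvatures `k₁, k₂, k₃` (indexed by `0, 1, 2`), for an arbitrary regular parameter. -/
def curvature (α : ℝ → E4) (i : Fin 3) (s : ℝ) : ℝ :=
  inner ℝ (deriv (fun u => frenetFrame α u i.castSucc) s) (frenetFrame α s i.succ) / ‖deriv α s‖

/-- Constant curvature ratios: `k₂ / k₁` and `k₃ / k₂` are constant on `I`. -/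
def IsCCR (I : Set ℝ) (α : ℝ → E4) : Prop :=
  ∀ i : Fin 2, ∃ c : ℝ, ∀ s ∈ I, curvature α i.succ s / curvature α i.castSucc s = c

/-- The last curvature never vanishes. -/
def IsTwisted (I : Set ℝ) (α : ℝ → E4) : Prop :=
  ∀ s ∈ I, curvature α 2 s ≠ 0

/-- All curvatures are constant on `I`. -/
def HasConstantCurvatures (I : Set ℝ) (α : ℝ → E4) : Prop :=
  ∀ i : Fin 3, ∃ c : ℝ, ∀ s ∈ I, curvature α i s = c

/-! ### Intrinsic geometry of a curve in the unit sphere `S³` -/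

/-- The curve `γ` lies on the unit sphere `S³` centred at the origin. -/
def IsSpherical (I : Set ℝ) (γ : ℝ → E4) : Prop :=
  ∀ s ∈ I, ‖γ s‖ = 1

/-- The Levi-Civita covariant derivative of `S³`, in the direction of the unit tangent of `γ`,
of a tangent vector field `X` of `S³` along `γ`: the tangential part of the arc-length
derivative of `X`. -/
def covDeriv (γ X : ℝ → E4) (s : ℝ) : E4 :=
  ‖deriv γ s‖⁻¹ • (deriv X s - inner ℝ (deriv X s) (γ s) • γ s)

/-- The unit tangent `t`. -/
def unitTangent (γ : ℝ → E4) (s : ℝ) : E4 := ‖deriv γ s‖⁻¹ • deriv γ s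

/-- The intrinsic curvature `κ = ‖∇ₜ t‖`. -/
def intrinsicCurvature (γ : ℝ → E4) (s : ℝ) : ℝ := ‖covDeriv γ (unitTangent γ) s‖

/-- The intrinsic principal normal `n`, with `∇ₜ t = κ n`; meaningful where `κ ≠ 0`. -/
def intrinsicNormal (γ : ℝ → E4) (s : ℝ) : E4 :=
  (intrinsicCurvature γ s)⁻¹ • covDeriv γ (unitTangent γ) s

/-- The intrinsic binormal `b`: the unit vector for which `t, n, b, γ` is a positive orthonormal
basis of `ℝ⁴`; meaningful where `κ ≠ 0`. -/
def intrinsicBinormal (γ : ℝ → E4) (s : ℝ) : E4 :=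
  cross3 (γ s) (intrinsicNormal γ s) (unitTangent γ s)

/-- The intrinsic torsion `τ = ⟪∇ₜ n, b⟫ = -⟪∇ₜ b, n⟫`; meaningful where `κ ≠ 0`. -/
def intrinsicTorsion (γ : ℝ → E4) (s : ℝ) : ℝ :=
  inner ℝ (covDeriv γ (intrinsicNormal γ) s) (intrinsicBinormal γ s)

/-- `Γ` is a variation of `γ` through curves `Γ t` in `S³`, `|t| < ε`, with variation field `V`. -/
structure IsVariation (I : Set ℝ) (γ V : ℝ → E4) (ε : ℝ) (Γ : ℝ → ℝ → E4) : Prop where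
  pos : 0 < ε
  contDiffOn : ContDiffOn ℝ 4 (fun p : ℝ × ℝ => Γ p.1 p.2) (Set.Ioo (-ε) ε ×ˢ I)
  spherical : ∀ t ∈ Set.Ioo (-ε) ε, IsSpherical I (Γ t)
  initial : ∀ s ∈ I, Γ 0 s = γ s
  field : ∀ s ∈ I, deriv (fun t => Γ t s) 0 = V s

/-- `V` is a Killing vector field along `γ`: to first order, the curve moves in the direction of
`V` without changing its speed, its intrinsic curvature and its intrinsic torsion, that is
`V(v) = V(κ²) = V(τ²) = 0`. The last condition is asked where `κ ≠ 0`, so that the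
torsion is defined. These first variations depend only on `V`, not on the variation `Γ`. -/
def IsKillingAlong (I : Set ℝ) (γ V : ℝ → E4) : Prop :=
  ∃ (ε : ℝ) (Γ : ℝ → ℝ → E4), IsVariation I γ V ε Γ ∧ ∀ s ∈ I,
    HasDerivAt (fun t => ‖deriv (Γ t) s‖) 0 0 ∧
    HasDerivAt (fun t => intrinsicCurvature (Γ t) s ^ 2) 0 0 ∧
    (intrinsicCurvature γ s ≠ 0 → HasDerivAt (fun t => intrinsicTorsion (Γ t) s ^ 2) 0 0)

/-- General helices of `S³`: there is a Killing vector field along the curve that has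
constant non-zero length and makes a constant angle with the tangent of the curve. -/
def IsGeneralHelix (I : Set ℝ) (γ : ℝ → E4) : Prop :=
  ∃ (V : ℝ → E4) (l θ : ℝ), IsKillingAlong I γ V ∧ l ≠ 0 ∧
    ∀ s ∈ I, ‖V s‖ = l ∧ InnerProductGeometry.angle (V s) (deriv γ s) = θ

end

noncomputable section

open Filter Topology InnerProductSpace

/-! The curve is described twice, by its curvatures k₁, k₂, k₃ in ℝ⁴ and by κ, τ in S³. The helix
condition and the condition on the ratios each relate κ and τ, and together they leave k₁ only
finitely many values near a generic point.

Helix side. Differentiating the identities for κ²v⁶ and τκ²v⁶ along the variation turns the Killing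
property into conditions linear in V (`IsRegularSpherical.isInfinitesimallyKilling`). Where κ and τ
do not vanish, constant length and constant angle force V = c t + d b with constants c, d. The
second-order condition then makes m = cκ - dτ constant, and the third-order one yields (m² - d²)κ' =
0. So κ is constant, or dτ = cκ - m with m² = d² and hence c² + m² = ‖V‖² ≠ 0
(`constant_curvature_or_affine_torsion`).

Ratio side. One has k₁² = κ² + 1 and τκ² = k₁²k₂⟨α, e₄⟩. If k₂ = c₁k₁ and k₃ = c₂k₂, then ⟨α, e₄⟩ +
c₂⟨α, e₂⟩ is a constant C; since k₁⟨α, e₂⟩ = -1, this gives τκ² = c₁k₁²(Ck₁ + c₂)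
(`exists_torsion_mul_curvature_sq_eq`).

Combination. Inserting this in dτ = cκ - m and squaring to remove odd powers of κ gives a polynomial
equation for k₁, nontrivial because its value at 0 is -(c² + m²). Thus k₁ is locally constant where
κτ ≠ 0. The remaining points have k₁ = 1 or k₁ = -c₂/C, so connectedness of I makes k₁ constant, and
k₂, k₃ follow from the ratios. -/

/-! ### Determinants, triple products and orthonormal frames in ℝ⁴. -/

lemma inner_eq_sum_four (x y : E4) :
    inner ℝ x y = x 0 * y 0 + x 1 * y 1 + x 2 * y 2 + x 3 * y 3 := by
  simp [PiLp.inner_apply, Fin.sum_univ_four, mul_comm]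

lemma det4_eq (u v w x : E4) :
    det4 u v w x =
      u 0 * (v 1 * (w 2 * x 3 - w 3 * x 2) - v 2 * (w 1 * x 3 - w 3 * x 1)
        + v 3 * (w 1 * x 2 - w 2 * x 1))
      - u 1 * (v 0 * (w 2 * x 3 - w 3 * x 2) - v 2 * (w 0 * x 3 - w 3 * x 0)
        + v 3 * (w 0 * x 2 - w 2 * x 0))
      + u 2 * (v 0 * (w 1 * x 3 - w 3 * x 1) - v 1 * (w 0 * x 3 - w 3 * x 0)
        + v 3 * (w 0 * x 1 - w 1 * x 0))
      - u 3 * (v 0 * (w 1 * x 2 - w 2 * x 1) - v 1 * (w 0 * x 2 - w 2 * x 0)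
        + v 2 * (w 0 * x 1 - w 1 * x 0)) := by
  simp [det4, Matrix.det_succ_row_zero, Fin.sum_univ_succ, Fin.succAbove]
  ring

lemma inner_cross3 (u v w x : E4) : inner ℝ (cross3 u v w) x = det4 u v w x := by
  simp [inner_eq_sum_four, cross3, det4_eq]
  ring

/-- The right side is the Gram determinant of the three vectors; the identity is checked in
coordinates. -/
lemma inner_cross3_self (u v w : E4) :
    inner ℝ (cross3 u v w) (cross3 u v w) =
      inner ℝ u u * (inner ℝ v v * inner ℝ w w - inner ℝ v w ^ 2)
      - inner ℝ u v * (inner ℝ u v * inner ℝ w w - inner ℝ v w * inner ℝ u w)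
      + inner ℝ u w * (inner ℝ u v * inner ℝ v w - inner ℝ v v * inner ℝ u w) := by
  simp only [inner_eq_sum_four]
  simp [cross3, det4_eq]
  ring

lemma inner_cross3_left (u v w : E4) : inner ℝ (cross3 u v w) u = 0 := by
  rw [inner_cross3, det4_eq]; ring

lemma inner_cross3_mid (u v w : E4) : inner ℝ (cross3 u v w) v = 0 := by
  rw [inner_cross3, det4_eq]; ring

lemma inner_cross3_right (u v w : E4) : inner ℝ (cross3 u v w) w = 0 := by
  rw [inner_cross3, det4_eq]; ring

/-- Four vectors are orthonormal, spelled out. -/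
structure IsFrame (a b c d : E4) : Prop where
  aa : inner ℝ a a = 1
  bb : inner ℝ b b = 1
  cc : inner ℝ c c = 1
  dd : inner ℝ d d = 1
  ab : inner ℝ a b = 0
  ac : inner ℝ a c = 0
  ad : inner ℝ a d = 0
  bc : inner ℝ b c = 0
  bd : inner ℝ b d = 0
  cd : inner ℝ c d = 0

lemma isFrame_cross3 {u v w : E4} (huu : inner ℝ u u = 1) (hvv : inner ℝ v v = 1)
    (hww : inner ℝ w w = 1) (huv : inner ℝ u v = 0) (huw : inner ℝ u w = 0)
    (hvw : inner ℝ v w = 0) : IsFrame u v w (cross3 u v w) where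
  aa := huu
  bb := hvv
  cc := hww
  dd := by rw [inner_cross3_self, huu, hvv, hww, huv, huw, hvw]; norm_num
  ab := huv
  ac := huw
  bc := hvw
  ad := by rw [real_inner_comm, inner_cross3_left]
  bd := by rw [real_inner_comm, inner_cross3_mid]
  cd := by rw [real_inner_comm, inner_cross3_right]

namespace IsFrame

variable {a b c d : E4}

lemma orthonormal (h : IsFrame a b c d) : Orthonormal ℝ ![a, b, c, d] := by
  obtain ⟨aa, bb, cc, dd, ab, ac, ad, bc, bd, cd⟩ := h
  rw [orthonormal_iff_ite]
  have ba := (real_inner_comm a b).trans ab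
  have ca := (real_inner_comm a c).trans ac
  have da := (real_inner_comm a d).trans ad
  have cb := (real_inner_comm b c).trans bc
  have db := (real_inner_comm b d).trans bd
  have dc := (real_inner_comm c d).trans cd
  intro i j
  fin_cases i <;> fin_cases j <;>
    simp [-inner_self_eq_norm_sq_to_K] <;> assumption

lemma expansion (h : IsFrame a b c d) (x : E4) :
    x = inner ℝ x a • a + inner ℝ x b • b + inner ℝ x c • c + inner ℝ x d • d := by
  have hsp : ⊤ ≤ Submodule.span ℝ (Set.range ![a, b, c, d]) := by
    have := (basisOfOrthonormalOfCardEqFinrank h.orthonormal (by simp)).span_eq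
    simpa using this.ge
  have := (OrthonormalBasis.mk h.orthonormal hsp).sum_repr' x
  simp only [OrthonormalBasis.coe_mk, Fin.sum_univ_four] at this
  simpa [real_inner_comm] using this.symm

lemma inner_eq (h : IsFrame a b c d) (x y : E4) :
    inner ℝ x y = inner ℝ x a * inner ℝ y a + inner ℝ x b * inner ℝ y b
      + inner ℝ x c * inner ℝ y c + inner ℝ x d * inner ℝ y d := by
  conv_lhs => rw [h.expansion x]
  simp only [inner_add_left, real_inner_smul_left]
  simp only [real_inner_comm y]

/-- Otherwise the unit vector `cross3 a b c` would be orthogonal to all four vectors of an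
orthonormal basis. -/
lemma det4_ne_zero (h : IsFrame a b c d) : det4 a b c d ≠ 0 := by
  have h1 := isFrame_cross3 h.aa h.bb h.cc h.ab h.ac h.bc
  intro h0
  have h2 := h.inner_eq (cross3 a b c) (cross3 a b c)
  rw [inner_cross3 a b c d, h0, h1.dd, inner_cross3_left, inner_cross3_mid,
    inner_cross3_right] at h2
  norm_num at h2

end IsFrame

lemma hasDerivAt_det4 {x y z w : ℝ → E4} {x' y' z' w' : E4} {t : ℝ} (hx : HasDerivAt x x' t)
    (hy : HasDerivAt y y' t) (hz : HasDerivAt z z' t) (hw : HasDerivAt w w' t) :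
    HasDerivAt (fun t => det4 (x t) (y t) (z t) (w t))
      (det4 x' (y t) (z t) (w t) + det4 (x t) y' (z t) (w t) + det4 (x t) (y t) z' (w t)
        + det4 (x t) (y t) (z t) w') t := by
  have hc : ∀ {x : ℝ → E4} {x' : E4}, HasDerivAt x x' t → ∀ i : Fin 4,
      HasDerivAt (fun t => x t i) (x' i) t := by
    intro x x' hx i
    exact (EuclideanSpace.proj (𝕜 := ℝ) i : E4 →L[ℝ] ℝ).hasFDerivAt.comp_hasDerivAt t hx
  have X := hc hx
  have Y := hc hy
  have Z := hc hz
  have T := hc hw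
  have zw : ∀ i j, HasDerivAt (fun t => z t i * w t j - z t j * w t i)
    (z' i * w t j + z t i * w' j - (z' j * w t i + z t j * w' i)) t := fun i j =>
    ((Z i).mul (T j)).sub ((Z j).mul (T i))
  simp only [det4_eq]
  refine HasDerivAt.congr_deriv (((((X 0).mul (((Y 1).mul (zw 2 3)).sub ((Y 2).mul (zw 1 3)) |>.add
    ((Y 3).mul (zw 1 2)))).sub ((X 1).mul (((Y 0).mul (zw 2 3)).sub ((Y 2).mul (zw 0 3)) |>.add
    ((Y 3).mul (zw 0 2))))).add ((X 2).mul (((Y 0).mul (zw 1 3)).sub ((Y 1).mul (zw 0 3)) |>.add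
    ((Y 3).mul (zw 0 1))))).sub ((X 3).mul (((Y 0).mul (zw 1 2)).sub ((Y 1).mul (zw 0 2)) |>.add
    ((Y 2).mul (zw 0 1))))) ?_
  simp only [Pi.mul_apply, Pi.sub_apply, Pi.add_apply]
  ring

lemma ContDiffOn.det4 {n : WithTop ℕ∞} {s : Set ℝ} {x y z w : ℝ → E4} (hx : ContDiffOn ℝ n x s)
    (hy : ContDiffOn ℝ n y s) (hz : ContDiffOn ℝ n z s) (hw : ContDiffOn ℝ n w s) :
    ContDiffOn ℝ n (fun t => _root_.det4 (x t) (y t) (z t) (w t)) s := by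
  have hc : ∀ {x : ℝ → E4}, ContDiffOn ℝ n x s → ∀ i : Fin 4,
      ContDiffOn ℝ n (fun t => x t i) s := by
    intro x hx i
    exact (EuclideanSpace.proj (𝕜 := ℝ) i : E4 →L[ℝ] ℝ).contDiff.comp_contDiffOn hx
  have X := hc hx
  have Y := hc hy
  have Z := hc hz
  have T := hc hw
  have zw : ∀ i j, ContDiffOn ℝ n (fun t => z t i * w t j - z t j * w t i) s := fun i j =>
    ((Z i).mul (T j)).sub ((Z j).mul (T i))
  simp only [det4_eq]
  exact (((((X 0).mul (((Y 1).mul (zw 2 3)).sub ((Y 2).mul (zw 1 3)) |>.add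
    ((Y 3).mul (zw 1 2)))).sub ((X 1).mul (((Y 0).mul (zw 2 3)).sub ((Y 2).mul (zw 0 3)) |>.add
    ((Y 3).mul (zw 0 2))))).add ((X 2).mul (((Y 0).mul (zw 1 3)).sub ((Y 1).mul (zw 0 3)) |>.add
    ((Y 3).mul (zw 0 1))))).sub ((X 3).mul (((Y 0).mul (zw 1 2)).sub ((Y 1).mul (zw 0 2)) |>.add
    ((Y 2).mul (zw 0 1)))))

lemma ContDiffOn.cross3 {n : WithTop ℕ∞} {s : Set ℝ} {x y z : ℝ → E4} (hx : ContDiffOn ℝ n x s)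
    (hy : ContDiffOn ℝ n y s) (hz : ContDiffOn ℝ n z s) :
    ContDiffOn ℝ n (fun t => _root_.cross3 (x t) (y t) (z t)) s := by
  rw [contDiffOn_euclidean]
  intro i
  exact hx.det4 hy hz contDiffOn_const

/-- The determinant in terms of coordinates with respect to a basis. -/
lemma det4_combination (a b c d : E4) (p q r s : Fin 4 → ℝ) :
    det4 (p 0 • a + p 1 • b + p 2 • c + p 3 • d) (q 0 • a + q 1 • b + q 2 • c + q 3 • d)
      (r 0 • a + r 1 • b + r 2 • c + r 3 • d) (s 0 • a + s 1 • b + s 2 • c + s 3 • d) =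
    det4 (WithLp.toLp 2 p) (WithLp.toLp 2 q) (WithLp.toLp 2 r) (WithLp.toLp 2 s)
      * det4 a b c d := by
  have h : Matrix.of ![(p 0 • a + p 1 • b + p 2 • c + p 3 • d).ofLp,
      (q 0 • a + q 1 • b + q 2 • c + q 3 • d).ofLp, (r 0 • a + r 1 • b + r 2 • c + r 3 • d).ofLp,
      (s 0 • a + s 1 • b + s 2 • c + s 3 • d).ofLp] =
      Matrix.of ![p, q, r, s] * Matrix.of ![a.ofLp, b.ofLp, c.ofLp, d.ofLp] := by
    ext i j
    fin_cases i <;> simp [Matrix.mul_apply, Fin.sum_univ_four]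
  rw [det4, h, Matrix.det_mul]
  rfl

/-- The product rule for a constant inner product; the coefficients in the Frenet equations,
intrinsic and extrinsic, come from it. -/
lemma inner_deriv_add_eq_zero {I : Set ℝ} (hI : IsOpen I) {x y : ℝ → E4} {x' y' : E4} {c s : ℝ}
    (hs : s ∈ I) (hc : ∀ u ∈ I, inner ℝ (x u) (y u) = c) (hx : HasDerivAt x x' s)
    (hy : HasDerivAt y y' s) : inner ℝ (x s) y' + inner ℝ x' (y s) = 0 := by
  have h1 : HasDerivAt (fun u => inner ℝ (x u) (y u)) 0 s :=
    (hasDerivAt_const s c).congr_of_eventuallyEq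
      (Filter.eventually_of_mem (hI.mem_nhds hs) fun u hu => hc u hu)
  exact (hx.inner ℝ hy).unique h1

lemma ContDiffOn.hasDerivAt_of_isOpen {F : Type*} [NormedAddCommGroup F] [NormedSpace ℝ F]
    {I : Set ℝ} {f : ℝ → F} {n : WithTop ℕ∞} (hf : ContDiffOn ℝ n f I) (hn : n ≠ 0)
    (hI : IsOpen I) {s : ℝ} (hs : s ∈ I) : HasDerivAt f (deriv f s) s :=
  ((hf.differentiableOn hn s hs).differentiableAt (hI.mem_nhds hs)).hasDerivAt

/-! ### Intrinsic Frenet theory of curves in S³. -/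

lemma covDeriv_eq_smul_normal {γ : ℝ → E4} {s : ℝ} (hκ : intrinsicCurvature γ s ≠ 0) :
    covDeriv γ (unitTangent γ) s = intrinsicCurvature γ s • intrinsicNormal γ s := by
  rw [intrinsicNormal, smul_inv_smul₀ hκ]

/-- Row operations remove all but the leading terms; meant for x, y, z the first three derivatives
of a curve g. -/
lemma det4_triangular (g x y z : E4) (a b c d e f : ℝ) :
    det4 g (a • y - b • x + g) (c • x) (d • z + e • y + f • x) = a * c * d * det4 g y x z := by
  simp only [det4_eq, PiLp.add_apply, PiLp.sub_apply, PiLp.smul_apply, smul_eq_mul]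
  ring

/-- A regular curve of class `C³` on the unit sphere. -/
structure IsRegularSpherical (I : Set ℝ) (γ : ℝ → E4) : Prop where
  isOpen : IsOpen I
  contDiffOn : ContDiffOn ℝ 3 γ I
  spherical : IsSpherical I γ
  deriv_ne_zero : ∀ s ∈ I, deriv γ s ≠ 0

namespace IsRegularSpherical

variable {I : Set ℝ} {γ : ℝ → E4} {s : ℝ}

lemma mono (h : IsRegularSpherical I γ) {J : Set ℝ} (hJ : IsOpen J) (hJI : J ⊆ I) :
    IsRegularSpherical J γ where
  isOpen := hJ
  contDiffOn := h.contDiffOn.mono hJI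
  spherical := fun s hs => h.spherical s (hJI hs)
  deriv_ne_zero := fun s hs => h.deriv_ne_zero s (hJI hs)

lemma contDiffOn_deriv (h : IsRegularSpherical I γ) : ContDiffOn ℝ 2 (deriv γ) I :=
  h.contDiffOn.deriv_of_isOpen h.isOpen (by norm_num)

lemma contDiffOn_deriv_two (h : IsRegularSpherical I γ) : ContDiffOn ℝ 1 (deriv (deriv γ)) I :=
  h.contDiffOn_deriv.deriv_of_isOpen h.isOpen (by norm_num)

lemma hasDerivAt (h : IsRegularSpherical I γ) (hs : s ∈ I) : HasDerivAt γ (deriv γ s) s :=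
  h.contDiffOn.hasDerivAt_of_isOpen (by norm_num) h.isOpen hs

lemma hasDerivAt_deriv (h : IsRegularSpherical I γ) (hs : s ∈ I) :
    HasDerivAt (deriv γ) (deriv (deriv γ) s) s :=
  h.contDiffOn_deriv.hasDerivAt_of_isOpen (by norm_num) h.isOpen hs

lemma hasDerivAt_deriv_two (h : IsRegularSpherical I γ) (hs : s ∈ I) :
    HasDerivAt (deriv (deriv γ)) (deriv (deriv (deriv γ)) s) s :=
  h.contDiffOn_deriv_two.hasDerivAt_of_isOpen (by norm_num) h.isOpen hs

lemma norm_deriv_ne_zero (h : IsRegularSpherical I γ) (hs : s ∈ I) : ‖deriv γ s‖ ≠ 0 :=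
  norm_ne_zero_iff.2 (h.deriv_ne_zero s hs)

lemma inner_self (h : IsRegularSpherical I γ) (hs : s ∈ I) : inner ℝ (γ s) (γ s) = 1 := by
  rw [real_inner_self_eq_norm_sq, h.spherical s hs]; norm_num

lemma inner_deriv_self (h : IsRegularSpherical I γ) (hs : s ∈ I) :
    inner ℝ (deriv γ s) (γ s) = 0 := by
  have := inner_deriv_add_eq_zero h.isOpen hs (fun u hu => h.inner_self hu) (h.hasDerivAt hs)
    (h.hasDerivAt hs)
  rw [real_inner_comm] at this
  linarith

lemma inner_deriv_two_self (h : IsRegularSpherical I γ) (hs : s ∈ I) :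
    inner ℝ (deriv (deriv γ) s) (γ s) = -‖deriv γ s‖ ^ 2 := by
  have := inner_deriv_add_eq_zero h.isOpen hs (fun u hu => h.inner_deriv_self hu)
    (h.hasDerivAt_deriv hs) (h.hasDerivAt hs)
  rw [real_inner_self_eq_norm_sq] at this
  linarith

lemma hasDerivAt_norm_deriv (h : IsRegularSpherical I γ) (hs : s ∈ I) :
    HasDerivAt (fun u => ‖deriv γ u‖)
      (inner ℝ (deriv γ s) (deriv (deriv γ) s) / ‖deriv γ s‖) s := by
  have h1 := (h.hasDerivAt_deriv hs).norm_sq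
  have hv := h.norm_deriv_ne_zero hs
  have h2 := h1.sqrt (by positivity)
  simp only [Real.sqrt_sq (norm_nonneg _)] at h2
  refine h2.congr_deriv ?_
  field_simp

lemma hasDerivAt_unitTangent (h : IsRegularSpherical I γ) (hs : s ∈ I) :
    HasDerivAt (unitTangent γ) (‖deriv γ s‖⁻¹ • deriv (deriv γ) s
      - (inner ℝ (deriv γ s) (deriv (deriv γ) s) / ‖deriv γ s‖ ^ 3) • deriv γ s) s := by
  have hv := h.norm_deriv_ne_zero hs
  refine ((((h.hasDerivAt_norm_deriv hs).inv hv).smul (h.hasDerivAt_deriv hs))).congr_deriv ?_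
  rw [sub_eq_add_neg, ← neg_smul]
  congr 2
  field_simp

/-- The last term, γ with coefficient 1, appears because ⟨γ'', γ⟩ = -v² on the unit sphere. -/
lemma covDeriv_unitTangent (h : IsRegularSpherical I γ) (hs : s ∈ I) :
    covDeriv γ (unitTangent γ) s = (‖deriv γ s‖ ^ 2)⁻¹ • deriv (deriv γ) s
      - (inner ℝ (deriv γ s) (deriv (deriv γ) s) / ‖deriv γ s‖ ^ 4) • deriv γ s + γ s := by
  have hv := h.norm_deriv_ne_zero hs
  rw [covDeriv, (h.hasDerivAt_unitTangent hs).deriv]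
  simp only [inner_sub_left, real_inner_smul_left, h.inner_deriv_self hs,
    h.inner_deriv_two_self hs]
  match_scalars <;> field_simp
  simp

/-- Clearing denominators leaves an expression in γ' and γ'' alone that can be differentiated along
a variation. -/
lemma intrinsicCurvature_sq (h : IsRegularSpherical I γ) (hs : s ∈ I) :
    intrinsicCurvature γ s ^ 2 * ‖deriv γ s‖ ^ 6 =
      inner ℝ (deriv (deriv γ) s) (deriv (deriv γ) s) * ‖deriv γ s‖ ^ 2 - ‖deriv γ s‖ ^ 6
        - inner ℝ (deriv γ s) (deriv (deriv γ) s) ^ 2 := by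
  have hv := h.norm_deriv_ne_zero hs
  rw [intrinsicCurvature, ← real_inner_self_eq_norm_sq, h.covDeriv_unitTangent hs]
  have e1 := real_inner_self_eq_norm_sq (deriv γ s)
  have e2 := h.inner_deriv_self hs
  have e3 := h.inner_deriv_two_self hs
  have e4 := real_inner_comm (deriv γ s) (γ s)
  have e5 := real_inner_comm (deriv (deriv γ) s) (γ s)
  have e6 := real_inner_comm (deriv (deriv γ) s) (deriv γ s)
  rw [e2] at e4
  rw [e3] at e5
  simp only [inner_add_left, inner_sub_left, inner_add_right, inner_sub_right,
    real_inner_smul_left, real_inner_smul_right, h.inner_self hs, e1, e2, e3, e4, e5, e6]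
  field_simp
  ring

lemma contDiffOn_unitTangent (h : IsRegularSpherical I γ) :
    ContDiffOn ℝ 2 (unitTangent γ) I :=
  ((h.contDiffOn_deriv.norm ℝ h.deriv_ne_zero).inv fun _ hs => h.norm_deriv_ne_zero hs).smul
    h.contDiffOn_deriv

lemma contDiffOn_covDeriv_unitTangent (h : IsRegularSpherical I γ) :
    ContDiffOn ℝ 1 (covDeriv γ (unitTangent γ)) I := by
  have h0 : ContDiffOn ℝ 1 γ I := h.contDiffOn.of_le (by norm_num)
  have h1 : ContDiffOn ℝ 1 (deriv γ) I := h.contDiffOn_deriv.of_le (by norm_num)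
  have h2 : ContDiffOn ℝ 1 (deriv (unitTangent γ)) I :=
    h.contDiffOn_unitTangent.deriv_of_isOpen h.isOpen (by norm_num)
  exact ((h1.norm ℝ h.deriv_ne_zero).inv fun _ hs => h.norm_deriv_ne_zero hs).smul
    (h2.sub ((h2.inner ℝ h0).smul h0))

lemma inner_covDeriv_self (h : IsRegularSpherical I γ) (hs : s ∈ I) (X : ℝ → E4) :
    inner ℝ (covDeriv γ X s) (γ s) = 0 := by
  rw [covDeriv, real_inner_smul_left, inner_sub_left, real_inner_smul_left, h.inner_self hs]
  simp

lemma inner_unitTangent_self (h : IsRegularSpherical I γ) (hs : s ∈ I) :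
    inner ℝ (unitTangent γ s) (γ s) = 0 := by
  rw [unitTangent, real_inner_smul_left, h.inner_deriv_self hs, mul_zero]

lemma inner_unitTangent_unitTangent (h : IsRegularSpherical I γ) (hs : s ∈ I) :
    inner ℝ (unitTangent γ s) (unitTangent γ s) = 1 := by
  have hv := h.norm_deriv_ne_zero hs
  rw [unitTangent, real_inner_smul_left, real_inner_smul_right, real_inner_self_eq_norm_sq]
  field_simp

lemma deriv_eq_smul_unitTangent (h : IsRegularSpherical I γ) (hs : s ∈ I) :
    deriv γ s = ‖deriv γ s‖ • unitTangent γ s := by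
  rw [unitTangent, smul_inv_smul₀ (h.norm_deriv_ne_zero hs)]

lemma hasDerivAt_unitTangent' (h : IsRegularSpherical I γ) (hs : s ∈ I) :
    HasDerivAt (unitTangent γ) (‖deriv γ s‖ • (covDeriv γ (unitTangent γ) s - γ s)) s := by
  have hv := h.norm_deriv_ne_zero hs
  refine (h.hasDerivAt_unitTangent hs).congr_deriv ?_
  rw [h.covDeriv_unitTangent hs]
  match_scalars <;> field_simp
  ring

lemma inner_unitTangent_covDeriv (h : IsRegularSpherical I γ) (hs : s ∈ I) :
    inner ℝ (unitTangent γ s) (covDeriv γ (unitTangent γ) s) = 0 := by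
  have hv := h.norm_deriv_ne_zero hs
  have h1 := inner_deriv_add_eq_zero h.isOpen hs (fun u hu => h.inner_unitTangent_unitTangent hu)
    (h.hasDerivAt_unitTangent' hs) (h.hasDerivAt_unitTangent' hs)
  rw [real_inner_comm, real_inner_smul_left, inner_sub_left, real_inner_comm _ (γ s),
    h.inner_unitTangent_self hs, real_inner_comm] at h1
  simpa [hv] using h1

lemma continuousOn_intrinsicCurvature (h : IsRegularSpherical I γ) :
    ContinuousOn (intrinsicCurvature γ) I :=
  h.contDiffOn_covDeriv_unitTangent.continuousOn.norm

lemma isOpen_inter_curvature_ne_zero (h : IsRegularSpherical I γ) :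
    IsOpen (I ∩ {s | intrinsicCurvature γ s ≠ 0}) :=
  h.continuousOn_intrinsicCurvature.isOpen_inter_preimage h.isOpen isOpen_compl_singleton

section CurvatureNeZero

variable (h : IsRegularSpherical I γ) (hκ : ∀ s ∈ I, intrinsicCurvature γ s ≠ 0)
include h hκ

lemma contDiffOn_intrinsicCurvature : ContDiffOn ℝ 1 (intrinsicCurvature γ) I :=
  h.contDiffOn_covDeriv_unitTangent.norm ℝ fun s hs => norm_ne_zero_iff.1 (hκ s hs)

lemma contDiffOn_intrinsicNormal : ContDiffOn ℝ 1 (intrinsicNormal γ) I :=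
  ((h.contDiffOn_intrinsicCurvature hκ).inv hκ).smul h.contDiffOn_covDeriv_unitTangent

lemma contDiffOn_intrinsicBinormal : ContDiffOn ℝ 1 (intrinsicBinormal γ) I :=
  ContDiffOn.cross3 (h.contDiffOn.of_le (by norm_num)) (h.contDiffOn_intrinsicNormal hκ)
    (h.contDiffOn_unitTangent.of_le (by norm_num))

lemma isFrame (hs : s ∈ I) : IsFrame (γ s) (intrinsicNormal γ s) (unitTangent γ s)
    (intrinsicBinormal γ s) := by
  refine isFrame_cross3 (h.inner_self hs) ?_ (h.inner_unitTangent_unitTangent hs) ?_ ?_ ?_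
  · have := hκ s hs
    rw [intrinsicNormal, real_inner_smul_left, real_inner_smul_right,
      real_inner_self_eq_norm_sq, ← intrinsicCurvature]
    field_simp
  · rw [intrinsicNormal, real_inner_smul_right, real_inner_comm, h.inner_covDeriv_self hs,
      mul_zero]
  · rw [real_inner_comm, h.inner_unitTangent_self hs]
  · rw [intrinsicNormal, real_inner_smul_left, real_inner_comm, h.inner_unitTangent_covDeriv hs,
      mul_zero]

lemma hasDerivAt_unitTangent_frenet (hs : s ∈ I) :
    HasDerivAt (unitTangent γ)
      (‖deriv γ s‖ • (intrinsicCurvature γ s • intrinsicNormal γ s - γ s)) s := by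
  rw [← covDeriv_eq_smul_normal (hκ s hs)]
  exact h.hasDerivAt_unitTangent' hs

lemma inner_deriv_normal_binormal (hs : s ∈ I) :
    inner ℝ (deriv (intrinsicNormal γ) s) (intrinsicBinormal γ s) =
      ‖deriv γ s‖ * intrinsicTorsion γ s := by
  have hv := h.norm_deriv_ne_zero hs
  rw [intrinsicTorsion, covDeriv, real_inner_smul_left, inner_sub_left, real_inner_smul_left,
    (h.isFrame hκ hs).ad]
  field_simp
  ring

lemma hasDerivAt_normal_frenet (hs : s ∈ I) :
    HasDerivAt (intrinsicNormal γ) (‖deriv γ s‖ • (-intrinsicCurvature γ s • unitTangent γ s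
      + intrinsicTorsion γ s • intrinsicBinormal γ s)) s := by
  have hn := (h.contDiffOn_intrinsicNormal hκ).hasDerivAt_of_isOpen (by norm_num) h.isOpen hs
  have F := h.isFrame hκ hs
  have e1 := inner_deriv_add_eq_zero h.isOpen hs (fun u hu => (h.isFrame hκ hu).ab)
    (h.hasDerivAt hs) hn
  have e2 := inner_deriv_add_eq_zero h.isOpen hs (fun u hu => (h.isFrame hκ hu).bb) hn hn
  have e3 := inner_deriv_add_eq_zero h.isOpen hs (fun u hu => (h.isFrame hκ hu).bc)
    hn (h.hasDerivAt_unitTangent_frenet hκ hs)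
  rw [h.deriv_eq_smul_unitTangent hs, real_inner_smul_left, real_inner_comm _ (unitTangent γ s),
    F.bc, real_inner_comm] at e1
  rw [real_inner_comm] at e2
  rw [real_inner_smul_right, inner_sub_right, real_inner_smul_right, F.bb,
    real_inner_comm (γ s), F.ab] at e3
  refine hn.congr_deriv ?_
  rw [F.expansion (deriv (intrinsicNormal γ) s), h.inner_deriv_normal_binormal hκ hs,
    show inner ℝ (deriv (intrinsicNormal γ) s) (γ s) = 0 by linarith,
    show inner ℝ (deriv (intrinsicNormal γ) s) (intrinsicNormal γ s) = 0 by linarith,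
    show inner ℝ (deriv (intrinsicNormal γ) s) (unitTangent γ s)
      = -(‖deriv γ s‖ * intrinsicCurvature γ s) by linarith]
  module

lemma hasDerivAt_binormal_frenet (hs : s ∈ I) :
    HasDerivAt (intrinsicBinormal γ)
      (-(‖deriv γ s‖ * intrinsicTorsion γ s) • intrinsicNormal γ s) s := by
  have hb := (h.contDiffOn_intrinsicBinormal hκ).hasDerivAt_of_isOpen (by norm_num) h.isOpen hs
  have F := h.isFrame hκ hs
  have e1 := inner_deriv_add_eq_zero h.isOpen hs (fun u hu => (h.isFrame hκ hu).ad)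
    (h.hasDerivAt hs) hb
  have e2 := inner_deriv_add_eq_zero h.isOpen hs (fun u hu => (h.isFrame hκ hu).bd)
    (h.hasDerivAt_normal_frenet hκ hs) hb
  have e3 := inner_deriv_add_eq_zero h.isOpen hs (fun u hu => (h.isFrame hκ hu).cd)
    (h.hasDerivAt_unitTangent_frenet hκ hs) hb
  have e4 := inner_deriv_add_eq_zero h.isOpen hs (fun u hu => (h.isFrame hκ hu).dd) hb hb
  rw [h.deriv_eq_smul_unitTangent hs, real_inner_smul_left, F.cd, real_inner_comm] at e1
  rw [real_inner_smul_left, inner_add_left, real_inner_smul_left, real_inner_smul_left, F.cd,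
    F.dd, real_inner_comm] at e2
  rw [real_inner_smul_left, inner_sub_left, real_inner_smul_left, F.bd, F.ad,
    real_inner_comm] at e3
  rw [real_inner_comm] at e4
  refine hb.congr_deriv ?_
  rw [F.expansion (deriv (intrinsicBinormal γ) s),
    show inner ℝ (deriv (intrinsicBinormal γ) s) (γ s) = 0 by linarith,
    show inner ℝ (deriv (intrinsicBinormal γ) s) (intrinsicBinormal γ s) = 0 by linarith,
    show inner ℝ (deriv (intrinsicBinormal γ) s) (unitTangent γ s) = 0 by linarith,
    show inner ℝ (deriv (intrinsicBinormal γ) s) (intrinsicNormal γ s)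
      = -(‖deriv γ s‖ * intrinsicTorsion γ s) by linarith]
  module

lemma hasDerivAt_covDeriv_unitTangent (hs : s ∈ I) :
    HasDerivAt (covDeriv γ (unitTangent γ))
      (deriv (intrinsicCurvature γ) s • intrinsicNormal γ s
        + (intrinsicCurvature γ s * ‖deriv γ s‖) • (-intrinsicCurvature γ s • unitTangent γ s
      + intrinsicTorsion γ s • intrinsicBinormal γ s)) s := by
  have h1 := ((h.contDiffOn_intrinsicCurvature hκ).hasDerivAt_of_isOpen (by norm_num) h.isOpen
    hs).smul (h.hasDerivAt_normal_frenet hκ hs)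
  refine (h1.congr_of_eventuallyEq (Filter.eventually_of_mem (h.isOpen.mem_nhds hs)
    fun u hu => covDeriv_eq_smul_normal (hκ u hu))).congr_deriv ?_
  rw [smul_smul, add_comm]

/-- The determinant of γ, ∇ₜt, t, (∇ₜt)' is computed twice: the Frenet equations give κ²vτ, and the
expression of ∇ₜt by derivatives of γ gives v⁻⁵ times the right side. -/
lemma torsion_mul (hs : s ∈ I) :
    intrinsicTorsion γ s * (intrinsicCurvature γ s ^ 2 * ‖deriv γ s‖ ^ 6) =
      det4 (γ s) (deriv (deriv γ) s) (deriv γ s) (deriv (deriv (deriv γ)) s) := by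
  have hv := h.norm_deriv_ne_zero hs
  have h1 : ContDiffOn ℝ 1 (deriv γ) I := h.contDiffOn_deriv.of_le (by norm_num)
  have hv1 : ContDiffOn ℝ 1 (fun u => ‖deriv γ u‖) I := h1.norm ℝ h.deriv_ne_zero
  have ha : ContDiffOn ℝ 1 (fun u => (‖deriv γ u‖ ^ 2)⁻¹) I :=
    (hv1.pow 2).inv fun u hu => pow_ne_zero 2 (h.norm_deriv_ne_zero hu)
  have hq : ContDiffOn ℝ 1
      (fun u => inner ℝ (deriv γ u) (deriv (deriv γ) u) / ‖deriv γ u‖ ^ 4) I :=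
    (h1.inner ℝ h.contDiffOn_deriv_two).div (hv1.pow 4)
      fun u hu => pow_ne_zero 4 (h.norm_deriv_ne_zero hu)
  have hX := (((ha.hasDerivAt_of_isOpen (by norm_num) h.isOpen hs).smul
    (h.hasDerivAt_deriv_two hs)).sub ((hq.hasDerivAt_of_isOpen (by norm_num) h.isOpen hs).smul
    (h.hasDerivAt_deriv hs))).add (h.hasDerivAt hs)
  have hX' := hX.congr_of_eventuallyEq (f₁ := covDeriv γ (unitTangent γ))
    (Filter.eventually_of_mem (h.isOpen.mem_nhds hs) fun u hu => h.covDeriv_unitTangent hu)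
  have key := hX'.unique (h.hasDerivAt_covDeriv_unitTangent hκ hs)
  have F := h.isFrame hκ hs
  have d1 : det4 (γ s) (covDeriv γ (unitTangent γ) s) (unitTangent γ s)
      (deriv (intrinsicCurvature γ) s • intrinsicNormal γ s
        + (intrinsicCurvature γ s * ‖deriv γ s‖) • (-intrinsicCurvature γ s • unitTangent γ s
      + intrinsicTorsion γ s • intrinsicBinormal γ s)) =
      intrinsicCurvature γ s ^ 2 * ‖deriv γ s‖ * intrinsicTorsion γ s := by
    rw [covDeriv_eq_smul_normal (hκ s hs)]
    trans intrinsicCurvature γ s ^ 2 * ‖deriv γ s‖ * intrinsicTorsion γ s *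
      det4 (γ s) (intrinsicNormal γ s) (unitTangent γ s) (intrinsicBinormal γ s)
    · simp only [det4_eq, PiLp.add_apply, PiLp.smul_apply, smul_eq_mul]
      ring
    · rw [← inner_cross3, ← intrinsicBinormal, F.dd, mul_one]
  rw [← key, h.covDeriv_unitTangent hs] at d1
  have d2 := det4_triangular (γ s) (deriv γ s) (deriv (deriv γ) s) (deriv (deriv (deriv γ)) s)
    (‖deriv γ s‖ ^ 2)⁻¹ (inner ℝ (deriv γ s) (deriv (deriv γ) s) / ‖deriv γ s‖ ^ 4)
    ‖deriv γ s‖⁻¹ (‖deriv γ s‖ ^ 2)⁻¹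
    (deriv (fun u => (‖deriv γ u‖ ^ 2)⁻¹) s
      - inner ℝ (deriv γ s) (deriv (deriv γ) s) / ‖deriv γ s‖ ^ 4)
    (1 - deriv (fun u => inner ℝ (deriv γ u) (deriv (deriv γ) u) / ‖deriv γ u‖ ^ 4) s)
  rw [unitTangent] at d1
  have d3 := d1.symm.trans ((congrArg _ (by module)).trans d2)
  field_simp at d3
  linear_combination d3

end CurvatureNeZero

end IsRegularSpherical

/-! ### Interchanging derivatives in a two-parameter family. -/

section MixedPartials

variable {F : Type*} [NormedAddCommGroup F] [NormedSpace ℝ F] {Ω : Set (ℝ × ℝ)}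
  {G : ℝ → ℝ → F} {t s : ℝ}

lemma hasDerivAt_snd_of_differentiableAt
    (h : DifferentiableAt ℝ (fun p : ℝ × ℝ => G p.1 p.2) (t, s)) :
    HasDerivAt (G t) (fderiv ℝ (fun p : ℝ × ℝ => G p.1 p.2) (t, s) (0, 1)) s :=
  h.hasFDerivAt.comp_hasDerivAt s ((hasDerivAt_const s t).prodMk (hasDerivAt_id s))

lemma hasDerivAt_fst_of_differentiableAt
    (h : DifferentiableAt ℝ (fun p : ℝ × ℝ => G p.1 p.2) (t, s)) :
    HasDerivAt (fun u => G u s) (fderiv ℝ (fun p : ℝ × ℝ => G p.1 p.2) (t, s) (1, 0)) t :=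
  HasFDerivAt.comp_hasDerivAt (f := fun u : ℝ => (u, s)) t h.hasFDerivAt
    ((hasDerivAt_id t).prodMk (hasDerivAt_const t s))

lemma ContDiffOn.fderiv_apply_of_isOpen {n m : WithTop ℕ∞} (hΩ : IsOpen Ω) {g : ℝ × ℝ → F}
    (hg : ContDiffOn ℝ n g Ω) (hmn : m + 1 ≤ n) (v : ℝ × ℝ) :
    ContDiffOn ℝ m (fun p => fderiv ℝ g p v) Ω :=
  (hg.fderiv_of_isOpen hΩ hmn).clm_apply contDiffOn_const

lemma contDiffOn_deriv_snd {n m : WithTop ℕ∞} (hΩ : IsOpen Ω)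
    (hG : ContDiffOn ℝ n (fun p : ℝ × ℝ => G p.1 p.2) Ω) (hmn : m + 1 ≤ n) :
    ContDiffOn ℝ m (fun p : ℝ × ℝ => deriv (G p.1) p.2) Ω := by
  refine (hG.fderiv_apply_of_isOpen hΩ hmn (0, 1)).congr fun p hp => ?_
  have hn : n ≠ 0 := by rintro rfl; simp at hmn
  exact (hasDerivAt_snd_of_differentiableAt
    ((hG.differentiableOn hn p hp).differentiableAt (hΩ.mem_nhds hp))).deriv

lemma contDiffOn_deriv_fst {n m : WithTop ℕ∞} (hΩ : IsOpen Ω)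
    (hG : ContDiffOn ℝ n (fun p : ℝ × ℝ => G p.1 p.2) Ω) (hmn : m + 1 ≤ n) :
    ContDiffOn ℝ m (fun p : ℝ × ℝ => deriv (fun u => G u p.2) p.1) Ω := by
  refine (hG.fderiv_apply_of_isOpen hΩ hmn (1, 0)).congr fun p hp => ?_
  have hn : n ≠ 0 := by rintro rfl; simp at hmn
  exact (hasDerivAt_fst_of_differentiableAt
    ((hG.differentiableOn hn p hp).differentiableAt (hΩ.mem_nhds hp))).deriv

/-- Mixed partial derivatives commute. -/
lemma deriv_deriv_comm (hΩ : IsOpen Ω)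
    (hG : ContDiffOn ℝ 2 (fun p : ℝ × ℝ => G p.1 p.2) Ω) (hp : (t, s) ∈ Ω) :
    deriv (fun u => deriv (G u) s) t = deriv (fun w => deriv (fun u => G u w) t) s := by
  set g : ℝ × ℝ → F := fun p => G p.1 p.2 with hg
  have hdiff : ∀ p ∈ Ω, DifferentiableAt ℝ g p := fun p hp =>
    (hG.differentiableOn (by norm_num) p hp).differentiableAt (hΩ.mem_nhds hp)
  have hf : DifferentiableAt ℝ (fderiv ℝ g) (t, s) :=
    ((hG.fderiv_of_isOpen hΩ (m := 1) (by norm_num)).differentiableOn (by norm_num) _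
      hp).differentiableAt (hΩ.mem_nhds hp)
  have e1 : (fun u => deriv (G u) s) =ᶠ[𝓝 t] fun u => fderiv ℝ g (u, s) (0, 1) := by
    have : ∀ᶠ u in 𝓝 t, (u, s) ∈ Ω :=
      (Continuous.prodMk continuous_id continuous_const).continuousAt.eventually
        (hΩ.mem_nhds hp)
    filter_upwards [this] with u hu
    exact (hasDerivAt_snd_of_differentiableAt (hdiff _ hu)).deriv
  have e2 : (fun w => deriv (fun u => G u w) t) =ᶠ[𝓝 s] fun w => fderiv ℝ g (t, w) (1, 0) := by
    have : ∀ᶠ w in 𝓝 s, (t, w) ∈ Ω :=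
      (Continuous.prodMk continuous_const continuous_id).continuousAt.eventually
        (hΩ.mem_nhds hp)
    filter_upwards [this] with w hw
    exact (hasDerivAt_fst_of_differentiableAt (hdiff _ hw)).deriv
  rw [e1.deriv_eq, e2.deriv_eq]
  have d1 : HasDerivAt (fun u => fderiv ℝ g (u, s)) (fderiv ℝ (fderiv ℝ g) (t, s) (1, 0)) t :=
    hf.hasFDerivAt.comp_hasDerivAt t ((hasDerivAt_id t).prodMk (hasDerivAt_const t s))
  have d2 : HasDerivAt (fun w => fderiv ℝ g (t, w)) (fderiv ℝ (fderiv ℝ g) (t, s) (0, 1)) s :=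
    hf.hasFDerivAt.comp_hasDerivAt s ((hasDerivAt_const s t).prodMk (hasDerivAt_id s))
  have d1' := (d1.clm_apply (hasDerivAt_const t ((0, 1) : ℝ × ℝ))).deriv
  have d2' := (d2.clm_apply (hasDerivAt_const s ((1, 0) : ℝ × ℝ))).deriv
  rw [d1', d2']
  simp only [map_zero, add_zero]
  have hsymm : IsSymmSndFDerivAt ℝ g (t, s) :=
    (hG.contDiffAt (hΩ.mem_nhds hp)).isSymmSndFDerivAt (by simp)
  exact hsymm.eq _ _

/-- Induction on k, applied to the partial derivative in the second variable. Each step costs one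
order of smoothness, so k = 3 uses C⁴. -/
lemma hasDerivAt_iteratedDeriv_fst (hΩ : IsOpen Ω) (k : ℕ) :
    ∀ {G : ℝ → ℝ → F}, ContDiffOn ℝ ((k + 1 : ℕ) : WithTop ℕ∞) (fun p : ℝ × ℝ => G p.1 p.2) Ω →
    (t, s) ∈ Ω → HasDerivAt (fun u => iteratedDeriv k (G u) s)
      (iteratedDeriv k (fun w => deriv (fun u => G u w) t) s) t := by
  induction k with
  | zero =>
    intro G hG hp
    have hd : DifferentiableAt ℝ (fun p : ℝ × ℝ => G p.1 p.2) (t, s) :=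
      (hG.differentiableOn (by norm_num) _ hp).differentiableAt (hΩ.mem_nhds hp)
    have h1 := hasDerivAt_fst_of_differentiableAt hd
    simp only [iteratedDeriv_zero]
    exact h1.differentiableAt.hasDerivAt
  | succ k ih =>
    intro G hG hp
    have h1 : ContDiffOn ℝ ((k + 1 : ℕ) : WithTop ℕ∞) (fun p : ℝ × ℝ => deriv (G p.1) p.2) Ω :=
      contDiffOn_deriv_snd hΩ hG (by norm_cast)
    have h2 := ih (G := fun t => deriv (G t)) h1 hp
    simp only [iteratedDeriv_succ']
    refine h2.congr_deriv ?_
    refine Filter.EventuallyEq.iteratedDeriv_eq k ?_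
    have : ∀ᶠ w in 𝓝 s, (t, w) ∈ Ω :=
      (Continuous.prodMk continuous_const continuous_id).continuousAt.eventually
        (hΩ.mem_nhds hp)
    filter_upwards [this] with w hw
    exact deriv_deriv_comm hΩ (hG.of_le (by norm_cast; omega)) hw

end MixedPartials

/-! ### First variation of speed, curvature and torsion. -/

section Variation

variable {I : Set ℝ} {γ V : ℝ → E4} {ε : ℝ} {Γ : ℝ → ℝ → E4} {s : ℝ}

/-- The neighbouring curves of a variation need not be regular on all of I, so the identities are
applied to them only at their regular points. -/
lemma isRegularSpherical_inter (hI : IsOpen I) (hγ : ContDiffOn ℝ 3 γ I)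
    (hs : IsSpherical I γ) : IsRegularSpherical (I ∩ {s | deriv γ s ≠ 0}) γ where
  isOpen := (hγ.deriv_of_isOpen hI (m := 2) (by norm_num)).continuousOn.isOpen_inter_preimage hI
    isOpen_compl_singleton
  contDiffOn := hγ.mono Set.inter_subset_left
  spherical := fun s hs' => hs s hs'.1
  deriv_ne_zero := fun _ hs' => hs'.2

lemma torsion_mul_of_ne_zero (hI : IsOpen I) (hγ : ContDiffOn ℝ 3 γ I) (hsph : IsSpherical I γ)
    (hs : s ∈ I) (hv : deriv γ s ≠ 0) (hκ : intrinsicCurvature γ s ≠ 0) :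
    intrinsicTorsion γ s * (intrinsicCurvature γ s ^ 2 * ‖deriv γ s‖ ^ 6) =
      det4 (γ s) (deriv (deriv γ) s) (deriv γ s) (deriv (deriv (deriv γ)) s) := by
  have h := isRegularSpherical_inter hI hγ hsph
  exact (h.mono h.isOpen_inter_curvature_ne_zero Set.inter_subset_left).torsion_mul
    (fun s hs => hs.2) ⟨⟨hs, hv⟩, hκ⟩

namespace IsVariation

lemma contDiffOn_slice (h : IsVariation I γ V ε Γ) {t : ℝ} (ht : t ∈ Set.Ioo (-ε) ε) :
    ContDiffOn ℝ 4 (Γ t) I :=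
  h.contDiffOn.comp (contDiff_const.prodMk contDiff_id).contDiffOn fun _ hs => ⟨ht, hs⟩

lemma zero_mem (h : IsVariation I γ V ε Γ) : (0 : ℝ) ∈ Set.Ioo (-ε) ε :=
  ⟨neg_lt_zero.2 h.pos, h.pos⟩

lemma contDiffOn_field (h : IsVariation I γ V ε Γ) (hI : IsOpen I) : ContDiffOn ℝ 3 V I := by
  have h1 := contDiffOn_deriv_fst (m := 3) (isOpen_Ioo.prod hI) h.contDiffOn (by norm_num)
  have h2 : ContDiffOn ℝ 3 (fun s => deriv (fun u => Γ u s) 0) I :=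
    h1.comp (contDiff_const.prodMk contDiff_id).contDiffOn fun _ hs => ⟨h.zero_mem, hs⟩
  exact h2.congr fun s hs => (h.field s hs).symm

lemma hasDerivAt_iteratedDeriv (h : IsVariation I γ V ε Γ) (hI : IsOpen I) (hs : s ∈ I) {k : ℕ}
    (hk : k ≤ 3) : HasDerivAt (fun t => iteratedDeriv k (Γ t) s) (iteratedDeriv k V s) 0 := by
  refine (hasDerivAt_iteratedDeriv_fst (isOpen_Ioo.prod hI) k
    (h.contDiffOn.of_le (by norm_cast; omega)) ⟨h.zero_mem, hs⟩).congr_deriv ?_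
  exact Filter.EventuallyEq.iteratedDeriv_eq k
    (Filter.eventually_of_mem (hI.mem_nhds hs) fun u hu => h.field u hu)

lemma iteratedDeriv_initial (h : IsVariation I γ V ε Γ) (hI : IsOpen I) (hs : s ∈ I) (k : ℕ) :
    iteratedDeriv k (Γ 0) s = iteratedDeriv k γ s :=
  Filter.EventuallyEq.iteratedDeriv_eq k
    (Filter.eventually_of_mem (hI.mem_nhds hs) fun u hu => h.initial u hu)

end IsVariation

/-- The linear conditions satisfied by a Killing vector field along a curve. -/
structure IsInfinitesimallyKilling (I : Set ℝ) (γ V : ℝ → E4) : Prop where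
  contDiffOn : ContDiffOn ℝ 3 V I
  inner_zero : ∀ s ∈ I, inner ℝ (V s) (γ s) = 0
  inner_one : ∀ s ∈ I, inner ℝ (deriv V s) (deriv γ s) = 0
  inner_two : ∀ s ∈ I, inner ℝ (deriv (deriv V) s) (deriv (deriv γ) s) = 0
  trace : ∀ s ∈ I, intrinsicCurvature γ s ≠ 0 → intrinsicTorsion γ s ≠ 0 →
    det4 (V s) (deriv (deriv γ) s) (deriv γ s) (deriv (deriv (deriv γ)) s)
    + det4 (γ s) (deriv (deriv V) s) (deriv γ s) (deriv (deriv (deriv γ)) s)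
    + det4 (γ s) (deriv (deriv γ) s) (deriv V s) (deriv (deriv (deriv γ)) s)
    + det4 (γ s) (deriv (deriv γ) s) (deriv γ s) (deriv (deriv (deriv V)) s) = 0

/-- Each condition is the derivative at t = 0 of an identity valid for all nearby curves: ‖Γ‖² = 1,
the speed, the formula for κ²v⁶, and the square of the formula for τκ²v⁶. -/
lemma IsRegularSpherical.isInfinitesimallyKilling (hγ : IsRegularSpherical I γ)
    (hV : IsKillingAlong I γ V) : IsInfinitesimallyKilling I γ V := by
  obtain ⟨ε, Γ, h, hK⟩ := hV
  have hI := hγ.isOpen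
  have hV3 := h.contDiffOn_field hI
  have hmem : ∀ᶠ t in 𝓝 (0 : ℝ), t ∈ Set.Ioo (-ε) ε := isOpen_Ioo.mem_nhds h.zero_mem
  have D0 : ∀ s ∈ I, HasDerivAt (fun t => Γ t s) (V s) 0 := fun s hs => by
    simpa using h.hasDerivAt_iteratedDeriv hI hs (k := 0) (by norm_num)
  have D1 : ∀ s ∈ I, HasDerivAt (fun t => deriv (Γ t) s) (deriv V s) 0 := fun s hs => by
    simpa [iteratedDeriv_succ] using h.hasDerivAt_iteratedDeriv hI hs (k := 1) (by norm_num)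
  have D2 : ∀ s ∈ I, HasDerivAt (fun t => deriv (deriv (Γ t)) s) (deriv (deriv V) s) 0 :=
    fun s hs => by
    simpa [iteratedDeriv_succ] using h.hasDerivAt_iteratedDeriv hI hs (k := 2) (by norm_num)
  have D3 : ∀ s ∈ I, HasDerivAt (fun t => deriv (deriv (deriv (Γ t))) s)
      (deriv (deriv (deriv V)) s) 0 := fun s hs => by
    simpa [iteratedDeriv_succ] using h.hasDerivAt_iteratedDeriv hI hs (k := 3) (by norm_num)
  have i1 : ∀ s ∈ I, deriv (Γ 0) s = deriv γ s := fun s hs => by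
    simpa [iteratedDeriv_succ] using h.iteratedDeriv_initial hI hs 1
  have i2 : ∀ s ∈ I, deriv (deriv (Γ 0)) s = deriv (deriv γ) s := fun s hs => by
    simpa [iteratedDeriv_succ] using h.iteratedDeriv_initial hI hs 2
  have i3 : ∀ s ∈ I, deriv (deriv (deriv (Γ 0))) s = deriv (deriv (deriv γ)) s := fun s hs => by
    simpa [iteratedDeriv_succ] using h.iteratedDeriv_initial hI hs 3
  have hreg : ∀ t ∈ Set.Ioo (-ε) ε, ContDiffOn ℝ 3 (Γ t) I := fun t ht =>
    (h.contDiffOn_slice ht).of_le (by norm_num)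
  have hne : ∀ s ∈ I, ∀ᶠ t in 𝓝 (0 : ℝ), deriv (Γ t) s ≠ 0 := fun s hs =>
    (D1 s hs).continuousAt.eventually_ne (by rw [i1 s hs]; exact hγ.deriv_ne_zero s hs)
  have K0 : ∀ s ∈ I, inner ℝ (V s) (γ s) = 0 := by
    intro s hs
    have := inner_deriv_add_eq_zero isOpen_Ioo h.zero_mem (c := 1) (x := fun t => Γ t s)
      (y := fun t => Γ t s) (fun t ht => by
        simp only [real_inner_self_eq_norm_sq, h.spherical t ht s hs]; norm_num) (D0 s hs) (D0 s hs)
    rw [real_inner_comm, h.initial s hs] at this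
    linarith
  have K1 : ∀ s ∈ I, inner ℝ (deriv V s) (deriv γ s) = 0 := by
    intro s hs
    have h1 := (hK s hs).1.pow 2
    have h2 := ((D1 s hs).norm_sq).unique h1
    rw [i1 s hs, real_inner_comm] at h2
    simpa using h2
  have hcv : ∀ s ∈ I, intrinsicCurvature (Γ 0) s = intrinsicCurvature γ s := by
    intro s hs
    have e1 := (isRegularSpherical_inter hI (hreg 0 h.zero_mem)
      (h.spherical 0 h.zero_mem)).intrinsicCurvature_sq
      (s := s) ⟨hs, by simpa [i1 s hs] using hγ.deriv_ne_zero s hs⟩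
    have e2 := hγ.intrinsicCurvature_sq hs
    rw [i1 s hs, i2 s hs, ← e2] at e1
    have e3 := mul_right_cancel₀ (pow_ne_zero 6 (hγ.norm_deriv_ne_zero hs)) e1
    exact (sq_eq_sq₀ (norm_nonneg _) (norm_nonneg _)).1 e3
  refine ⟨hV3, K0, K1, ?_, ?_⟩
  · intro s hs
    have hv := hγ.norm_deriv_ne_zero hs
    have hV1 := (hV3.deriv_of_isOpen hI (m := 2) (by norm_num)).hasDerivAt_of_isOpen
      (by norm_num) hI hs
    -- The variation of ⟨γ', γ''⟩ is the s-derivative of ⟨V', γ'⟩ = 0, so it drops out of the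
    -- variation of κ²v⁶.
    have cross := inner_deriv_add_eq_zero hI hs K1 hV1 (hγ.hasDerivAt_deriv hs)
    have hvd := (hK s hs).1
    have l := (hK s hs).2.1.mul (hvd.pow 6)
    have r := ((((D2 s hs).inner ℝ (D2 s hs)).mul (hvd.pow 2)).sub (hvd.pow 6)).sub
      (((D1 s hs).inner ℝ (D2 s hs)).pow 2)
    have hev : ∀ᶠ t in 𝓝 (0 : ℝ), intrinsicCurvature (Γ t) s ^ 2 * ‖deriv (Γ t) s‖ ^ 6 =
        inner ℝ (deriv (deriv (Γ t)) s) (deriv (deriv (Γ t)) s) * ‖deriv (Γ t) s‖ ^ 2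
        - ‖deriv (Γ t) s‖ ^ 6 - inner ℝ (deriv (Γ t) s) (deriv (deriv (Γ t)) s) ^ 2 := by
      filter_upwards [hmem, hne s hs] with t ht hn
      exact (isRegularSpherical_inter hI (hreg t ht) (h.spherical t ht)).intrinsicCurvature_sq
        ⟨hs, hn⟩
    have u := (l.congr_of_eventuallyEq (hev.mono fun t ht => ht.symm)).unique r
    rw [i1 s hs, i2 s hs] at u
    rw [real_inner_comm (deriv (deriv V) s), real_inner_comm (deriv (deriv V) s)] at u
    simp only [Pi.pow_apply, i1 s hs, mul_zero, zero_mul, add_zero, sub_zero] at u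
    have : ‖deriv γ s‖ ^ 2 * inner ℝ (deriv (deriv V) s) (deriv (deriv γ) s) = 0 := by
      norm_num at u
      linear_combination (-1 / 2) * u + inner ℝ (deriv γ s) (deriv (deriv γ) s) * cross
    simpa [hv] using this
  · intro s hs hκ hτ
    have hv := hγ.norm_deriv_ne_zero hs
    have hvd := (hK s hs).1
    have hκd := (hK s hs).2.1
    have hκne : ∀ᶠ t in 𝓝 (0 : ℝ), intrinsicCurvature (Γ t) s ≠ 0 :=
      (hκd.continuousAt.eventually_ne (by rw [hcv s hs]; exact pow_ne_zero 2 hκ)).mono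
        fun t ht h0 => ht (by rw [h0]; norm_num)
    have hev : ∀ᶠ t in 𝓝 (0 : ℝ), intrinsicTorsion (Γ t) s ^ 2 *
        ((intrinsicCurvature (Γ t) s ^ 2) ^ 2 * ‖deriv (Γ t) s‖ ^ 12) =
        det4 (Γ t s) (deriv (deriv (Γ t)) s) (deriv (Γ t) s) (deriv (deriv (deriv (Γ t))) s) ^ 2 := by
      filter_upwards [hmem, hne s hs, hκne] with t ht hn hk
      rw [← torsion_mul_of_ne_zero hI (hreg t ht) (h.spherical t ht) hs hn hk]
      ring
    have l := ((hK s hs).2.2 hκ).mul ((hκd.pow 2).mul (hvd.pow 12))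
    have r := (hasDerivAt_det4 (D0 s hs) (D2 s hs) (D1 s hs) (D3 s hs)).pow 2
    have u := (l.congr_of_eventuallyEq (hev.mono fun t ht => ht.symm)).unique r
    rw [i1 s hs, i2 s hs, i3 s hs, h.initial s hs, ← torsion_mul_of_ne_zero hI hγ.contDiffOn
      hγ.spherical hs (hγ.deriv_ne_zero s hs) hκ] at u
    simp only [mul_zero, zero_mul, add_zero] at u
    have u' := u.symm
    rw [mul_eq_zero] at u'
    -- The variation of the squared determinant is twice the determinant times its variation; the
    -- determinant is nonzero since κ and τ are.
    refine u'.resolve_left ?_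
    have : intrinsicTorsion γ s * (intrinsicCurvature γ s ^ 2 * ‖deriv γ s‖ ^ 6) ≠ 0 := by
      positivity
    simpa using this

end Variation

/-! ### Helices where curvature and torsion do not vanish. -/

lemma IsFrame.inner_combination {a b c d : E4} (h : IsFrame a b c d) (p q : Fin 4 → ℝ) :
    inner ℝ (p 0 • a + p 1 • b + p 2 • c + p 3 • d) (q 0 • a + q 1 • b + q 2 • c + q 3 • d) =
      p 0 * q 0 + p 1 * q 1 + p 2 * q 2 + p 3 * q 3 := by
  simp only [inner_add_left, inner_add_right, real_inner_smul_left, real_inner_smul_right,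
    real_inner_comm a b, real_inner_comm a c, real_inner_comm a d, real_inner_comm b c,
    real_inner_comm b d, real_inner_comm c d, h.aa, h.bb, h.cc, h.dd, h.ab, h.ac, h.ad, h.bc,
    h.bd, h.cd]
  ring

lemma exists_eq_const_of_hasDerivAt_zero {I : Set ℝ} (hI : IsOpen I) (hc : IsPreconnected I)
    {f : ℝ → ℝ} (hf : ∀ s ∈ I, HasDerivAt f 0 s) : ∃ c, ∀ s ∈ I, f s = c :=
  hI.exists_is_const_of_deriv_eq_zero hc
    (fun s hs => (hf s hs).differentiableAt.differentiableWithinAt) fun s hs => (hf s hs).deriv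

lemma exists_eq_const_of_finite {I : Set ℝ} (hc : IsPreconnected I) {f : ℝ → ℝ}
    (hf : ContinuousOn f I) {T : Set ℝ} (hT : T.Finite) (hm : ∀ s ∈ I, f s ∈ T) :
    ∃ c, ∀ s ∈ I, f s = c := by
  rcases I.eq_empty_or_nonempty with rfl | ⟨s₀, h₀⟩
  · exact ⟨0, by simp⟩
  · exact ⟨f s₀, fun s hs => hc.constant_of_mapsTo hT.isDiscrete hf hm hs h₀⟩

lemma exists_eq_const_of_sq_eq {I : Set ℝ} (hc : IsPreconnected I) {f : ℝ → ℝ}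
    (hf : ContinuousOn f I) {k : ℝ} (hk : ∀ s ∈ I, f s ^ 2 = k) :
    ∃ c, ∀ s ∈ I, f s = c := by
  refine exists_eq_const_of_finite hc hf (Set.toFinite {√k, -√k}) fun s hs => ?_
  have := Real.sqrt_sq_eq_abs (f s)
  rw [hk s hs] at this
  rcases abs_choice (f s) with h | h <;> simp [this, h]

lemma IsInfinitesimallyKilling.mono {I J : Set ℝ} {γ V : ℝ → E4}
    (h : IsInfinitesimallyKilling I γ V) (hJ : J ⊆ I) : IsInfinitesimallyKilling J γ V where
  contDiffOn := h.contDiffOn.mono hJ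
  inner_zero := fun s hs => h.inner_zero s (hJ hs)
  inner_one := fun s hs => h.inner_one s (hJ hs)
  inner_two := fun s hs => h.inner_two s (hJ hs)
  trace := fun s hs => h.trace s (hJ hs)

namespace IsRegularSpherical

variable {I : Set ℝ} {γ V : ℝ → E4} {s c l : ℝ}

/-- The determinant formula makes τ a quotient of C¹ functions; the numerator contains γ''', hence
the C⁴ hypothesis. -/
lemma differentiableAt_intrinsicTorsion (h : IsRegularSpherical I γ) (h4 : ContDiffOn ℝ 4 γ I)
    (hκ : ∀ s ∈ I, intrinsicCurvature γ s ≠ 0) (hs : s ∈ I) :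
    DifferentiableAt ℝ (intrinsicTorsion γ) s := by
  have c1 : ContDiffOn ℝ 3 (deriv γ) I := h4.deriv_of_isOpen h.isOpen (by norm_num)
  have c2 : ContDiffOn ℝ 2 (deriv (deriv γ)) I := c1.deriv_of_isOpen h.isOpen (by norm_num)
  have c3 : ContDiffOn ℝ 1 (deriv (deriv (deriv γ))) I := c2.deriv_of_isOpen h.isOpen (by norm_num)
  have c1' : ContDiffOn ℝ 1 (deriv γ) I := c1.of_le (by norm_num)
  have hD := ContDiffOn.det4 (h4.of_le (by norm_num)) (c2.of_le (by norm_num)) c1' c3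
  have hd : ∀ s ∈ I, intrinsicCurvature γ s ^ 2 * ‖deriv γ s‖ ^ 6 ≠ 0 := fun s hs =>
    mul_ne_zero (pow_ne_zero 2 (hκ s hs)) (pow_ne_zero 6 (h.norm_deriv_ne_zero hs))
  have hq := hD.div (((h.contDiffOn_intrinsicCurvature hκ).pow 2).mul
    ((c1'.norm ℝ h.deriv_ne_zero).pow 6)) hd
  have hτ : ContDiffOn ℝ 1 (intrinsicTorsion γ) I := hq.congr fun s hs =>
    eq_div_of_mul_eq (hd s hs) (h.torsion_mul hκ hs)
  exact (hτ.hasDerivAt_of_isOpen (by norm_num) h.isOpen hs).differentiableAt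

/-- Along a curve with non-zero curvature and torsion, an infinitesimally Killing field of constant
length and constant angle with the tangent has constant coordinates in the Frenet frame. -/
lemma exists_killing_eq (h : IsRegularSpherical I γ) (hc : IsPreconnected I)
    (hκ : ∀ s ∈ I, intrinsicCurvature γ s ≠ 0) (hV : IsInfinitesimallyKilling I γ V)
    (hVt : ∀ s ∈ I, inner ℝ (V s) (unitTangent γ s) = c) (hVl : ∀ s ∈ I, ‖V s‖ = l) :
    ∃ d, (∀ s ∈ I, V s = c • unitTangent γ s + d • intrinsicBinormal γ s) ∧
      (I.Nonempty → c ^ 2 + d ^ 2 = l ^ 2) := by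
  -- Differentiating ⟨V, t⟩ = c leaves vκ⟨V, n⟩ = 0.
  have hn : ∀ s ∈ I, inner ℝ (V s) (intrinsicNormal γ s) = 0 := by
    intro s hs
    have hv := h.norm_deriv_ne_zero hs
    have e := inner_deriv_add_eq_zero h.isOpen hs hVt
      (hV.contDiffOn.hasDerivAt_of_isOpen (by norm_num) h.isOpen hs)
      (h.hasDerivAt_unitTangent_frenet hκ hs)
    rw [real_inner_smul_right, inner_sub_right, real_inner_smul_right, hV.inner_zero s hs,
      unitTangent, real_inner_smul_right, hV.inner_one s hs] at e
    simpa [hv, hκ s hs] using e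
  have hsq : ∀ s ∈ I, inner ℝ (V s) (intrinsicBinormal γ s) ^ 2 = l ^ 2 - c ^ 2 := by
    intro s hs
    have e := (h.isFrame hκ hs).inner_eq (V s) (V s)
    rw [real_inner_self_eq_norm_sq, hVl s hs, hV.inner_zero s hs, hn s hs, hVt s hs] at e
    linarith
  obtain ⟨d, hd⟩ := exists_eq_const_of_sq_eq hc
    (hV.contDiffOn.continuousOn.inner (h.contDiffOn_intrinsicBinormal hκ).continuousOn) hsq
  refine ⟨d, fun s hs => ?_, fun ⟨s, hs⟩ => ?_⟩
  · have e := (h.isFrame hκ hs).expansion (V s)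
    rw [hV.inner_zero s hs, hn s hs, hVt s hs, hd s hs] at e
    simpa using e
  · have := hsq s hs
    rw [hd s hs] at this
    linarith

/-- With V = c t + d b, the second-order condition says cκ - dτ is a constant m and the third-order
one says mκτ' = (mτ + d)κ'. Eliminating τ' gives (m² - d²)κ' = 0. The bound c² + m² ≠ 0 keeps the
later polynomial nontrivial. -/
lemma constant_curvature_or_affine_torsion (h : IsRegularSpherical I γ)
    (h4 : ContDiffOn ℝ 4 γ I) (hne : I.Nonempty) (hc : IsPreconnected I)
    (hκ : ∀ s ∈ I, intrinsicCurvature γ s ≠ 0) (hτ : ∀ s ∈ I, intrinsicTorsion γ s ≠ 0)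
    (hV : IsInfinitesimallyKilling I γ V)
    (hVt : ∀ s ∈ I, inner ℝ (V s) (unitTangent γ s) = c) (hVl : ∀ s ∈ I, ‖V s‖ = l)
    (hl : l ≠ 0) :
    (∃ k, ∀ s ∈ I, intrinsicCurvature γ s = k) ∨
      ∃ d m, d ≠ 0 ∧ c ^ 2 + m ^ 2 ≠ 0 ∧
        ∀ s ∈ I, d * intrinsicTorsion γ s = c * intrinsicCurvature γ s - m := by
  obtain ⟨d, hVeq, hcd⟩ := h.exists_killing_eq hc hκ hV hVt hVl
  replace hcd := hcd hne
  set t := unitTangent γ with ht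
  set n := intrinsicNormal γ with hnn
  set b := intrinsicBinormal γ with hb
  set κ := intrinsicCurvature γ with hκd
  set τ := intrinsicTorsion γ with hτd
  set v : ℝ → ℝ := fun s => ‖deriv γ s‖ with hvd
  have hv : ∀ s ∈ I, v s ≠ 0 := fun s hs => h.norm_deriv_ne_zero hs
  have F : ∀ s ∈ I, IsFrame (γ s) (n s) (t s) (b s) := fun s hs => h.isFrame hκ hs
  have dγ : ∀ s ∈ I, HasDerivAt γ (v s • t s) s := fun s hs =>
    (h.hasDerivAt hs).congr_deriv (h.deriv_eq_smul_unitTangent hs)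
  have dt : ∀ s ∈ I, HasDerivAt t (v s • (κ s • n s - γ s)) s := fun s hs =>
    h.hasDerivAt_unitTangent_frenet hκ hs
  have dn : ∀ s ∈ I, HasDerivAt n (v s • (-κ s • t s + τ s • b s)) s := fun s hs =>
    h.hasDerivAt_normal_frenet hκ hs
  have db : ∀ s ∈ I, HasDerivAt b (-(v s * τ s) • n s) s := fun s hs =>
    h.hasDerivAt_binormal_frenet hκ hs
  have cv : ContDiffOn ℝ 3 v I :=
    (h4.deriv_of_isOpen h.isOpen (by norm_num)).norm ℝ h.deriv_ne_zero
  have dv : ∀ s ∈ I, HasDerivAt v (deriv v s) s := fun s hs =>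
    cv.hasDerivAt_of_isOpen (by norm_num) h.isOpen hs
  have cv' : ContDiffOn ℝ 2 (deriv v) I := cv.deriv_of_isOpen h.isOpen (by norm_num)
  have dv' : ∀ s ∈ I, HasDerivAt (deriv v) (deriv (deriv v) s) s := fun s hs =>
    cv'.hasDerivAt_of_isOpen (by norm_num) h.isOpen hs
  have dκ : ∀ s ∈ I, HasDerivAt κ (deriv κ s) s := fun s hs =>
    (h.contDiffOn_intrinsicCurvature hκ).hasDerivAt_of_isOpen (by norm_num) h.isOpen hs
  have dτ : ∀ s ∈ I, HasDerivAt τ (deriv τ s) s := fun s hs =>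
    (h.differentiableAt_intrinsicTorsion h4 hκ hs).hasDerivAt
  have near : ∀ {f g : ℝ → E4} {f' : E4} {s : ℝ}, s ∈ I → (∀ u ∈ I, g u = f u) →
      HasDerivAt f f' s → HasDerivAt g f' s := fun hs hfg hf =>
    hf.congr_of_eventuallyEq (Filter.eventually_of_mem (h.isOpen.mem_nhds hs) hfg)
  have g1 : ∀ s ∈ I, deriv γ s = v s • t s := fun s hs => (dγ s hs).deriv
  have g2 : ∀ s ∈ I, deriv (deriv γ) s = v s • v s • (κ s • n s - γ s) + deriv v s • t s :=
    fun s hs => (near hs g1 ((dv s hs).smul (dt s hs))).deriv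
  have V1 : ∀ s ∈ I, deriv V s = v s • ((c * κ s - d * τ s) • n s - c • γ s) := by
    intro s hs
    rw [(near hs hVeq (((dt s hs).const_smul c).add ((db s hs).const_smul d))).deriv]
    module
  have dm : ∀ s ∈ I, HasDerivAt (fun s => c * κ s - d * τ s) (c * deriv κ s - d * deriv τ s) s :=
    fun s hs => ((dκ s hs).const_mul c).sub ((dτ s hs).const_mul d)
  have m' : ∀ s ∈ I, c * deriv κ s - d * deriv τ s = 0 := by
    intro s hs
    have V2 := (near hs V1
      ((dv s hs).smul (((dm s hs).smul (dn s hs)).sub ((dγ s hs).const_smul c)))).deriv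
    have K := hV.inner_two s hs
    -- Coordinates of V'' and γ'' in the frame γ, n, t, b; their inner product collapses to v³κ(cκ -
    -- dτ)'.
    have e := (F s hs).inner_combination
      ![-c * deriv v s, v s * (c * deriv κ s - d * deriv τ s)
        + deriv v s * (c * κ s - d * τ s), -v s ^ 2 * ((c * κ s - d * τ s) * κ s + c),
        v s ^ 2 * (c * κ s - d * τ s) * τ s]
      ![-v s ^ 2, v s ^ 2 * κ s, deriv v s, 0]
    simp only [Matrix.cons_val] at e
    rw [V2, g2 s hs] at K
    have K' := (Eq.trans (by congr 1 <;> module) K).symm.trans e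
    have : v s ^ 3 * κ s * (c * deriv κ s - d * deriv τ s) = 0 := by
      linear_combination -K'
    simpa [hv s hs, hκ s hs] using this
  obtain ⟨m, hm⟩ := exists_eq_const_of_hasDerivAt_zero h.isOpen hc
    fun s hs => (dm s hs).congr_deriv (m' s hs)
  have V1' : ∀ s ∈ I, deriv V s = v s • (m • n s - c • γ s) := fun s hs => by
    rw [V1 s hs, hm s hs]
  have V2 : ∀ s ∈ I, deriv (deriv V) s = v s • v s • (-(m * κ s + c) • t s + (m * τ s) • b s)
      + deriv v s • (m • n s - c • γ s) := by
    intro s hs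
    rw [(near hs V1' ((dv s hs).smul (((dn s hs).const_smul m).sub
      ((dγ s hs).const_smul c)))).deriv]
    module
  have key : ∀ s ∈ I, m * κ s * deriv τ s = (m * τ s + d) * deriv κ s := by
    intro s hs
    have g3 := (near hs g2 (((dv s hs).smul ((dv s hs).smul (((dκ s hs).smul (dn s hs)).sub
      (dγ s hs)))).add ((dv' s hs).smul (dt s hs)))).deriv
    have V3 := (near hs V2 (((dv s hs).smul ((dv s hs).smul
      (((((dκ s hs).const_mul m).add_const c).neg.smul (dt s hs)).add
        (((dτ s hs).const_mul m).smul (db s hs))))).add ((dv' s hs).smul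
        (((dn s hs).const_smul m).sub ((dγ s hs).const_smul c))))).deriv
    simp only [Pi.smul_apply', Pi.sub_apply, Pi.add_apply, Pi.neg_apply] at g3 V3
    have T := hV.trace s hs (hκ s hs) (hτ s hs)
    -- The p's and q's are the coordinates of γ, V and their first three derivatives in the frame γ,
    -- n, t, b. All four determinants then share the nonzero factor det(γ, n, t, b).
    set p0 : Fin 4 → ℝ := ![1, 0, 0, 0] with hp0
    set p1 : Fin 4 → ℝ := ![0, 0, v s, 0] with hp1
    set p2 : Fin 4 → ℝ := ![-v s ^ 2, v s ^ 2 * κ s, deriv v s, 0] with hp2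
    set p3 : Fin 4 → ℝ := ![-3 * v s * deriv v s, 3 * v s * deriv v s * κ s
      + v s ^ 2 * deriv κ s, deriv (deriv v) s - v s ^ 3 * κ s ^ 2 - v s ^ 3,
      v s ^ 3 * κ s * τ s] with hp3
    set q0 : Fin 4 → ℝ := ![0, 0, c, d] with hq0
    set q1 : Fin 4 → ℝ := ![-c * v s, m * v s, 0, 0] with hq1
    set q2 : Fin 4 → ℝ := ![-c * deriv v s, m * deriv v s, -v s ^ 2 * (m * κ s + c),
      v s ^ 2 * m * τ s] with hq2
    set q3 : Fin 4 → ℝ := ![-c * deriv (deriv v) s + v s ^ 3 * (m * κ s + c),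
      m * deriv (deriv v) s - v s ^ 3 * κ s * (m * κ s + c) - v s ^ 3 * m * τ s ^ 2,
      -3 * v s * deriv v s * (m * κ s + c) - v s ^ 2 * m * deriv κ s,
      3 * v s * deriv v s * m * τ s + v s ^ 2 * m * deriv τ s] with hq3
    have P0 : γ s = p0 0 • γ s + p0 1 • n s + p0 2 • t s + p0 3 • b s := by
      simp [hp0]
    have P1 : deriv γ s = p1 0 • γ s + p1 1 • n s + p1 2 • t s + p1 3 • b s := by
      rw [g1 s hs]; simp [hp1]
    have P2 : deriv (deriv γ) s = p2 0 • γ s + p2 1 • n s + p2 2 • t s + p2 3 • b s := by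
      rw [g2 s hs]; simp only [hp2, Matrix.cons_val]; module
    have P3 : deriv (deriv (deriv γ)) s =
        p3 0 • γ s + p3 1 • n s + p3 2 • t s + p3 3 • b s := by
      rw [g3]; simp only [hp3, Matrix.cons_val]; module
    have Q0 : V s = q0 0 • γ s + q0 1 • n s + q0 2 • t s + q0 3 • b s := by
      rw [hVeq s hs]; simp [hq0]
    have Q1 : deriv V s = q1 0 • γ s + q1 1 • n s + q1 2 • t s + q1 3 • b s := by
      rw [V1' s hs]; simp only [hq1, Matrix.cons_val]; module
    have Q2 : deriv (deriv V) s = q2 0 • γ s + q2 1 • n s + q2 2 • t s + q2 3 • b s := by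
      rw [V2 s hs]; simp only [hq2, Matrix.cons_val]; module
    have Q3 : deriv (deriv (deriv V)) s =
        q3 0 • γ s + q3 1 • n s + q3 2 • t s + q3 3 • b s := by
      rw [V3]; simp only [hq3, Matrix.cons_val]; module
    have R1 := det4_combination (γ s) (n s) (t s) (b s) q0 p2 p1 p3
    have R2 := det4_combination (γ s) (n s) (t s) (b s) p0 q2 p1 p3
    have R3 := det4_combination (γ s) (n s) (t s) (b s) p0 p2 q1 p3
    have R4 := det4_combination (γ s) (n s) (t s) (b s) p0 p2 p1 q3
    rw [← Q0, ← P2, ← P1, ← P3] at R1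
    rw [← P0, ← Q2, ← P1, ← P3] at R2
    rw [← P0, ← P2, ← Q1, ← P3] at R3
    rw [← P0, ← P2, ← P1, ← Q3] at R4
    rw [R1, R2, R3, R4, ← add_mul, ← add_mul, ← add_mul, mul_eq_zero] at T
    replace T := T.resolve_right (F s hs).det4_ne_zero
    simp only [det4_eq, hp0, hp1, hp2, hp3, hq0, hq1, hq2, hq3, Matrix.cons_val] at T
    have : v s ^ 5 * (m * κ s * deriv τ s - (m * τ s + d) * deriv κ s) = 0 := by
      linear_combination T
    have := (mul_eq_zero.1 this).resolve_left (pow_ne_zero 5 (hv s hs))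
    linarith
  have conc : (∀ s ∈ I, deriv κ s = 0) → ∃ k, ∀ s ∈ I, κ s = k := fun h0 =>
    exists_eq_const_of_hasDerivAt_zero h.isOpen hc fun s hs => (dκ s hs).congr_deriv (h0 s hs)
  by_cases hd0 : d = 0
  · left
    refine conc fun s hs => ?_
    have hc0 : c ≠ 0 := by
      rintro rfl
      simp only [hd0, ne_eq, OfNat.ofNat_ne_zero, not_false_eq_true, zero_pow, add_zero] at hcd
      exact hl (pow_eq_zero_iff two_ne_zero |>.1 hcd.symm)
    have := m' s hs
    simpa [hd0, hc0] using this
  by_cases hmd : m ^ 2 = d ^ 2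
  · right
    refine ⟨d, m, hd0, ?_, fun s hs => by linarith [hm s hs]⟩
    rw [hmd, hcd]
    exact pow_ne_zero 2 hl
  · left
    refine conc fun s hs => ?_
    have : (m ^ 2 - d ^ 2) * deriv κ s = 0 := by
      linear_combination d * key s hs + m * κ s * m' s hs - m * deriv κ s * hm s hs
    exact (mul_eq_zero.1 this).resolve_left (sub_ne_zero.2 hmd)

end IsRegularSpherical

/-! ### The Gram–Schmidt frame in ℝ⁴ and its smoothness. -/

/-- The unnormalized Gram-Schmidt vectors of the derivatives of a curve. -/
def gsVector (α : ℝ → E4) (j : ℕ) (s : ℝ) : E4 :=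
  gramSchmidt ℝ (fun i : ℕ => iteratedDeriv (i + 1) α s) j

lemma gsFrame_eq (α : ℝ → E4) (s : ℝ) (j : ℕ) :
    gsFrame α s j = ‖gsVector α j s‖⁻¹ • gsVector α j s := rfl

lemma inner_gsVector (α : ℝ → E4) (s : ℝ) {i j : ℕ} (hij : i ≠ j) :
    inner ℝ (gsVector α i s) (gsVector α j s) = 0 :=
  gramSchmidt_orthogonal ℝ _ hij

lemma inner_gsFrame (α : ℝ → E4) (s : ℝ) {i j : ℕ} (hij : i ≠ j) :
    inner ℝ (gsFrame α s i) (gsFrame α s j) = 0 := by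
  rw [gsFrame_eq, gsFrame_eq, real_inner_smul_left, real_inner_smul_right, inner_gsVector α s hij]
  simp

lemma gsVector_zero (α : ℝ → E4) (s : ℝ) : gsVector α 0 s = deriv α s := by
  have := gramSchmidt_def'' ℝ (fun i : ℕ => iteratedDeriv (i + 1) α s) 0
  simpa [iteratedDeriv_succ, gsVector] using this.symm

lemma gsVector_one (α : ℝ → E4) (s : ℝ) : gsVector α 1 s = deriv (deriv α) s
    - (inner ℝ (gsVector α 0 s) (deriv (deriv α) s) / ‖gsVector α 0 s‖ ^ 2) • gsVector α 0 s := by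
  have := gramSchmidt_def'' ℝ (fun i : ℕ => iteratedDeriv (i + 1) α s) 1
  simp only [iteratedDeriv_succ, iteratedDeriv_zero, Nat.Iio_eq_range, Finset.sum_range_succ,
    Finset.sum_range_zero, zero_add, RCLike.ofReal_real_eq_id, id] at this
  rw [eq_sub_iff_add_eq]
  simp only [gsVector, iteratedDeriv_succ]
  exact this.symm

lemma gsVector_two (α : ℝ → E4) (s : ℝ) : gsVector α 2 s = deriv (deriv (deriv α)) s
    - ((inner ℝ (gsVector α 0 s) (deriv (deriv (deriv α)) s) / ‖gsVector α 0 s‖ ^ 2)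
      • gsVector α 0 s
    + (inner ℝ (gsVector α 1 s) (deriv (deriv (deriv α)) s) / ‖gsVector α 1 s‖ ^ 2)
      • gsVector α 1 s) := by
  have := gramSchmidt_def'' ℝ (fun i : ℕ => iteratedDeriv (i + 1) α s) 2
  simp only [iteratedDeriv_succ, iteratedDeriv_zero, Nat.Iio_eq_range, Finset.sum_range_succ,
    Finset.sum_range_zero, zero_add, RCLike.ofReal_real_eq_id, id] at this
  rw [eq_sub_iff_add_eq]
  simp only [gsVector, iteratedDeriv_succ]
  exact this.symm

lemma frenetFrame_zero (α : ℝ → E4) (s : ℝ) : frenetFrame α s 0 = gsFrame α s 0 := rfl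

lemma frenetFrame_one (α : ℝ → E4) (s : ℝ) : frenetFrame α s 1 = gsFrame α s 1 := rfl

lemma frenetFrame_two (α : ℝ → E4) (s : ℝ) : frenetFrame α s 2 = gsFrame α s 2 := rfl

lemma frenetFrame_three (α : ℝ → E4) (s : ℝ) : frenetFrame α s 3 =
    cross3 (frenetFrame α s 0) (frenetFrame α s 1) (frenetFrame α s 2) := rfl

lemma frenetFrame_zero_eq_unitTangent (α : ℝ → E4) (s : ℝ) :
    frenetFrame α s 0 = unitTangent α s := by
  rw [frenetFrame_zero, gsFrame_eq, gsVector_zero, unitTangent]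

namespace IsFrenetCurve

variable {I : Set ℝ} {α : ℝ → E4} {s : ℝ}

/-- The j-th vector involves only the indices up to j, so independence of the first three
derivatives suffices although the family is infinite. -/
lemma gsVector_ne_zero (hα : IsFrenetCurve I α) (hs : s ∈ I) {j : ℕ} (hj : j < 3) :
    gsVector α j s ≠ 0 := by
  refine gramSchmidt_ne_zero_coe j ?_
  have h := hα.linearIndependent s hs
  exact h.comp (fun k : Set.Iic j => (⟨k.1, lt_of_le_of_lt k.2 hj⟩ : Fin 3)) fun a b hab =>
    Subtype.ext (by simpa using hab)

lemma isRegularSpherical (hα : IsFrenetCurve I α) (hI : IsOpen I) (hsph : IsSpherical I α) :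
    IsRegularSpherical I α where
  isOpen := hI
  contDiffOn := hα.contDiffOn.of_le (by norm_num)
  spherical := hsph
  deriv_ne_zero := fun s hs => by
    rw [← gsVector_zero]
    exact hα.gsVector_ne_zero hs (by norm_num)

lemma contDiffOn_gsVector (hα : IsFrenetCurve I α) (hI : IsOpen I) {j : ℕ} (hj : j < 3) :
    ContDiffOn ℝ 1 (gsVector α j) I := by
  have c1 : ContDiffOn ℝ 3 (deriv α) I := hα.contDiffOn.deriv_of_isOpen hI (by norm_num)
  have c2 : ContDiffOn ℝ 2 (deriv (deriv α)) I := c1.deriv_of_isOpen hI (by norm_num)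
  have c3 : ContDiffOn ℝ 1 (deriv (deriv (deriv α))) I := c2.deriv_of_isOpen hI (by norm_num)
  have n0 : ∀ s ∈ I, gsVector α 0 s ≠ 0 := fun s hs => hα.gsVector_ne_zero hs (by norm_num)
  have n1 : ∀ s ∈ I, gsVector α 1 s ≠ 0 := fun s hs => hα.gsVector_ne_zero hs (by norm_num)
  have g0 : ContDiffOn ℝ 1 (gsVector α 0) I :=
    (c1.of_le (by norm_num)).congr fun s _ => gsVector_zero α s
  have coef : ∀ {g f : ℝ → E4}, ContDiffOn ℝ 1 g I → ContDiffOn ℝ 1 f I → (∀ s ∈ I, g s ≠ 0) →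
      ContDiffOn ℝ 1 (fun s => (inner ℝ (g s) (f s) / ‖g s‖ ^ 2) • g s) I := fun hg hf hn =>
    ((hg.inner ℝ hf).div ((hg.norm ℝ hn).pow 2)
      fun s hs => pow_ne_zero 2 (norm_ne_zero_iff.2 (hn s hs))).smul hg
  have g1 : ContDiffOn ℝ 1 (gsVector α 1) I :=
    ((c2.of_le (by norm_num)).sub (coef g0 (c2.of_le (by norm_num)) n0)).congr
      fun s _ => gsVector_one α s
  have g2 : ContDiffOn ℝ 1 (gsVector α 2) I :=
    (c3.sub ((coef g0 c3 n0).add (coef g1 c3 n1))).congr fun s _ => gsVector_two α s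
  interval_cases j
  exacts [g0, g1, g2]

lemma contDiffOn_gsFrame (hα : IsFrenetCurve I α) (hI : IsOpen I) {j : ℕ} (hj : j < 3) :
    ContDiffOn ℝ 1 (fun s => gsFrame α s j) I :=
  (((hα.contDiffOn_gsVector hI hj).norm ℝ fun _ hs => hα.gsVector_ne_zero hs hj).inv
    fun _ hs => norm_ne_zero_iff.2 (hα.gsVector_ne_zero hs hj)).smul (hα.contDiffOn_gsVector hI hj)

lemma hasDerivAt_frenetFrame (hα : IsFrenetCurve I α) (hI : IsOpen I) (hs : s ∈ I) (i : Fin 4) :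
    HasDerivAt (fun u => frenetFrame α u i) (deriv (fun u => frenetFrame α u i) s) s := by
  have h0 := hα.contDiffOn_gsFrame hI (j := 0) (by norm_num)
  have h1 := hα.contDiffOn_gsFrame hI (j := 1) (by norm_num)
  have h2 := hα.contDiffOn_gsFrame hI (j := 2) (by norm_num)
  have h3 := h0.cross3 h1 h2
  have : ContDiffOn ℝ 1 (fun u => frenetFrame α u i) I := by
    fin_cases i
    exacts [h0, h1, h2, h3]
  exact this.hasDerivAt_of_isOpen (by norm_num) hI hs

lemma isFrame (hα : IsFrenetCurve I α) (hs : s ∈ I) : IsFrame (frenetFrame α s 0)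
    (frenetFrame α s 1) (frenetFrame α s 2) (frenetFrame α s 3) := by
  have hu : ∀ j < 3, inner ℝ (gsFrame α s j) (gsFrame α s j) = 1 := by
    intro j hj
    have hn := norm_ne_zero_iff.2 (hα.gsVector_ne_zero hs hj)
    rw [gsFrame_eq, real_inner_smul_left, real_inner_smul_right, real_inner_self_eq_norm_sq]
    field_simp
  exact isFrame_cross3 (hu 0 (by norm_num)) (hu 1 (by norm_num)) (hu 2 (by norm_num))
    (inner_gsFrame α s (by norm_num)) (inner_gsFrame α s (by norm_num))
    (inner_gsFrame α s (by norm_num))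

lemma gsVector_eq_smul (hα : IsFrenetCurve I α) (hs : s ∈ I) {j : ℕ} (hj : j < 3) :
    gsVector α j s = ‖gsVector α j s‖ • gsFrame α s j := by
  rw [gsFrame_eq, smul_inv_smul₀ (norm_ne_zero_iff.2 (hα.gsVector_ne_zero hs hj))]

lemma exists_deriv_two_eq (hα : IsFrenetCurve I α) (hs : s ∈ I) : ∃ r : ℝ,
    deriv (deriv α) s = ‖gsVector α 1 s‖ • frenetFrame α s 1 + r • frenetFrame α s 0 := by
  have h := gsVector_one α s
  rw [hα.gsVector_eq_smul hs (j := 0) (by norm_num), sub_eq_add_neg, ← sub_eq_iff_eq_add,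
    sub_neg_eq_add, smul_smul, hα.gsVector_eq_smul hs (j := 1) (by norm_num)] at h
  exact ⟨_, h.symm⟩

lemma exists_deriv_three_eq (hα : IsFrenetCurve I α) (hs : s ∈ I) : ∃ p q : ℝ,
    deriv (deriv (deriv α)) s = ‖gsVector α 2 s‖ • frenetFrame α s 2 + p • frenetFrame α s 1
      + q • frenetFrame α s 0 := by
  have h := gsVector_two α s
  rw [eq_sub_iff_add_eq] at h
  have h0 := hα.gsVector_eq_smul hs (j := 0) (by norm_num)
  have h1 := hα.gsVector_eq_smul hs (j := 1) (by norm_num)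
  have h2 := hα.gsVector_eq_smul hs (j := 2) (by norm_num)
  refine ⟨inner ℝ (gsVector α 1 s) (deriv (deriv (deriv α)) s) / ‖gsVector α 1 s‖ ^ 2
    * ‖gsVector α 1 s‖, inner ℝ (gsVector α 0 s) (deriv (deriv (deriv α)) s)
    / ‖gsVector α 0 s‖ ^ 2 * ‖gsVector α 0 s‖, ?_⟩
  rw [mul_smul, mul_smul, frenetFrame_zero, frenetFrame_one, frenetFrame_two, ← h0, ← h1, ← h2]
  refine h.symm.trans ?_
  abel

end IsFrenetCurve

/-! ### Curvatures in ℝ⁴ compared with curvature and torsion in S³. -/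

lemma det4_frame_combination (g a b c : E4) (v p q r x y : ℝ) :
    det4 g (p • b + q • a) (v • a) (r • c + x • b + y • a) = v * p * r * det4 a b c g := by
  simp only [det4_eq, PiLp.add_apply, PiLp.smul_apply, smul_eq_mul]
  ring

namespace IsFrenetCurve

variable {I : Set ℝ} {α : ℝ → E4} {s : ℝ} (hα : IsFrenetCurve I α) (hI : IsOpen I)
  (hsph : IsSpherical I α)
include hα hI

lemma inner_deriv_frenetFrame (hs : s ∈ I) {i j : Fin 4} {c : ℝ}
    (hc : ∀ u ∈ I, inner ℝ (frenetFrame α u i) (frenetFrame α u j) = c) :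
    inner ℝ (frenetFrame α s i) (deriv (fun u => frenetFrame α u j) s)
      + inner ℝ (deriv (fun u => frenetFrame α u i) s) (frenetFrame α s j) = 0 :=
  inner_deriv_add_eq_zero hI hs hc (hα.hasDerivAt_frenetFrame hI hs i)
    (hα.hasDerivAt_frenetFrame hI hs j)

include hsph

lemma inner_deriv_frenet_succ (hs : s ∈ I) (i : Fin 3) :
    inner ℝ (deriv (fun u => frenetFrame α u i.castSucc) s) (frenetFrame α s i.succ) =
      ‖deriv α s‖ * curvature α i s := by
  have hv := (hα.isRegularSpherical hI hsph).norm_deriv_ne_zero hs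
  rw [curvature]
  field_simp

lemma deriv_frenetFrame_zero (hs : s ∈ I) :
    deriv (fun u => frenetFrame α u 0) s =
      ‖deriv α s‖ • (covDeriv α (unitTangent α) s - α s) := by
  simp only [frenetFrame_zero_eq_unitTangent]
  exact ((hα.isRegularSpherical hI hsph).hasDerivAt_unitTangent' hs).deriv

/-- e₁' is a combination of α' and α'', hence of e₁ and e₂, and its e₁-component vanishes because e₁
has unit length. -/
lemma deriv_frenetFrame_zero_eq_gs (hs : s ∈ I) :
    deriv (fun u => frenetFrame α u 0) s =
      (‖deriv α s‖⁻¹ * ‖gsVector α 1 s‖) • frenetFrame α s 1 := by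
  have R := hα.isRegularSpherical hI hsph
  have hv := R.norm_deriv_ne_zero hs
  have F := hα.isFrame hs
  obtain ⟨r, hr⟩ := hα.exists_deriv_two_eq hs
  have e1 : deriv α s = ‖deriv α s‖ • frenetFrame α s 0 := by
    rw [frenetFrame_zero_eq_unitTangent]; exact R.deriv_eq_smul_unitTangent hs
  have e2 : ∃ w : ℝ, deriv (fun u => frenetFrame α u 0) s =
      (‖deriv α s‖⁻¹ * ‖gsVector α 1 s‖) • frenetFrame α s 1 + w • frenetFrame α s 0 := by
    simp only [frenetFrame_zero_eq_unitTangent α]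
    rw [(R.hasDerivAt_unitTangent hs).deriv, hr]
    nth_rewrite 4 [e1]
    rw [frenetFrame_zero_eq_unitTangent]
    refine ⟨‖deriv α s‖⁻¹ * r - inner ℝ (deriv α s) (‖gsVector α 1 s‖ • frenetFrame α s 1
      + r • unitTangent α s) / ‖deriv α s‖ ^ 3 * ‖deriv α s‖, ?_⟩
    module
  obtain ⟨w, hw⟩ := e2
  have h0 := hα.inner_deriv_frenetFrame hI hs (i := 0) (j := 0) fun u hu => (hα.isFrame hu).aa
  rw [real_inner_comm, hw, inner_add_left, real_inner_smul_left, real_inner_smul_left,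
    real_inner_comm, F.ab, F.aa] at h0
  rw [hw, show w = 0 by linarith, zero_smul, add_zero]

lemma norm_gsVector_one (hs : s ∈ I) :
    ‖gsVector α 1 s‖ = ‖deriv α s‖ ^ 2 * curvature α 0 s := by
  have hv := (hα.isRegularSpherical hI hsph).norm_deriv_ne_zero hs
  have h := hα.inner_deriv_frenet_succ hI hsph hs 0
  simp only [Fin.castSucc_zero, Fin.succ_zero_eq_one] at h
  rw [hα.deriv_frenetFrame_zero_eq_gs hI hsph hs, real_inner_smul_left,
    (hα.isFrame hs).bb] at h
  field_simp at h
  linarith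

lemma curvature_zero_pos (hs : s ∈ I) : 0 < curvature α 0 s := by
  have h := hα.norm_gsVector_one hI hsph hs
  have hg : 0 < ‖gsVector α 1 s‖ := norm_pos_iff.2 (hα.gsVector_ne_zero hs (by norm_num))
  rw [h] at hg
  exact pos_of_mul_pos_right hg (by positivity)

lemma deriv_frenetFrame_zero_eq (hs : s ∈ I) :
    deriv (fun u => frenetFrame α u 0) s =
      (‖deriv α s‖ * curvature α 0 s) • frenetFrame α s 1 := by
  have hv := (hα.isRegularSpherical hI hsph).norm_deriv_ne_zero hs
  rw [hα.deriv_frenetFrame_zero_eq_gs hI hsph hs, hα.norm_gsVector_one hI hsph hs]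
  congr 1
  field_simp

/-- Pythagoras for k₁e₂ = ∇ₜt - α, whose two terms are orthogonal. -/
lemma curvature_zero_sq (hs : s ∈ I) :
    curvature α 0 s ^ 2 = intrinsicCurvature α s ^ 2 + 1 := by
  have R := hα.isRegularSpherical hI hsph
  have hv := R.norm_deriv_ne_zero hs
  have h := (hα.deriv_frenetFrame_zero_eq hI hsph hs).symm.trans
    (hα.deriv_frenetFrame_zero hI hsph hs)
  rw [mul_smul] at h
  have h1 := smul_right_injective _ hv h
  have h2 : inner ℝ (curvature α 0 s • frenetFrame α s 1) (curvature α 0 s • frenetFrame α s 1) =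
      inner ℝ (covDeriv α (unitTangent α) s - α s) (covDeriv α (unitTangent α) s - α s) := by
    rw [show curvature α 0 s • frenetFrame α s 1 = _ from h1]
  rw [real_inner_smul_left, real_inner_smul_right, (hα.isFrame hs).bb, inner_sub_left,
    inner_sub_right, inner_sub_right, R.inner_self hs, real_inner_comm _ (α s),
    R.inner_covDeriv_self hs, real_inner_self_eq_norm_sq, ← intrinsicCurvature] at h2
  linarith

/-- Differentiating ⟨α'', e₃⟩ = 0 gives ⟨α''', e₃⟩ = -⟨α'', e₃'⟩, which only the e₂-component of α''
feeds. -/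
lemma norm_gsVector_two (hs : s ∈ I) :
    ‖gsVector α 2 s‖ = ‖deriv α s‖ ^ 3 * curvature α 0 s * curvature α 1 s := by
  have R := hα.isRegularSpherical hI hsph
  have F := hα.isFrame hs
  have h0 : ∀ u ∈ I, inner ℝ (deriv (deriv α) u) (frenetFrame α u 2) = 0 := by
    intro u hu
    obtain ⟨r, hr⟩ := hα.exists_deriv_two_eq hu
    rw [hr, inner_add_left, real_inner_smul_left, real_inner_smul_left, (hα.isFrame hu).bc,
      (hα.isFrame hu).ac]
    ring
  have h1 := inner_deriv_add_eq_zero hI hs h0 (R.hasDerivAt_deriv_two hs)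
    (hα.hasDerivAt_frenetFrame hI hs 2)
  have h2 := hα.inner_deriv_frenetFrame hI hs (i := 0) (j := 2) fun u hu => (hα.isFrame hu).ac
  have h3 := hα.inner_deriv_frenetFrame hI hs (i := 1) (j := 2) fun u hu => (hα.isFrame hu).bc
  have h4 := hα.inner_deriv_frenet_succ hI hsph hs 1
  simp only [Fin.castSucc_one, Fin.succ_one_eq_two] at h4
  obtain ⟨r, hr⟩ := hα.exists_deriv_two_eq hs
  obtain ⟨p, q, hpq⟩ := hα.exists_deriv_three_eq hs
  rw [h4] at h3
  rw [hα.deriv_frenetFrame_zero_eq hI hsph hs, real_inner_smul_left, F.bc] at h2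
  rw [hr, hpq, inner_add_left, inner_add_left, inner_add_left, real_inner_smul_left,
    real_inner_smul_left, real_inner_smul_left, real_inner_smul_left, real_inner_smul_left, F.cc,
    F.ac, F.bc, hα.norm_gsVector_one hI hsph hs] at h1
  linear_combination h1 - ‖deriv α s‖ ^ 2 * curvature α 0 s * h3 - r * h2

lemma curvature_one_ne_zero (hs : s ∈ I) : curvature α 1 s ≠ 0 := by
  intro h0
  have h := hα.norm_gsVector_two hI hsph hs
  rw [h0, mul_zero, norm_eq_zero] at h
  exact hα.gsVector_ne_zero hs (by norm_num) h

/-- The determinant formula for τ is evaluated in the extrinsic frame, where α', α'', α''' are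
triangular with diagonal v, v²k₁, v³k₁k₂. -/
lemma torsion_mul_curvature_sq (hs : s ∈ I) (hκ : intrinsicCurvature α s ≠ 0) :
    intrinsicTorsion α s * intrinsicCurvature α s ^ 2 =
      curvature α 0 s ^ 2 * curvature α 1 s * inner ℝ (α s) (frenetFrame α s 3) := by
  have R := hα.isRegularSpherical hI hsph
  have hv := R.norm_deriv_ne_zero hs
  have h := torsion_mul_of_ne_zero hI R.contDiffOn hsph hs (R.deriv_ne_zero s hs) hκ
  obtain ⟨r, hr⟩ := hα.exists_deriv_two_eq hs
  obtain ⟨p, q, hpq⟩ := hα.exists_deriv_three_eq hs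
  have e := det4_frame_combination (α s) (frenetFrame α s 0) (frenetFrame α s 1)
    (frenetFrame α s 2) ‖deriv α s‖ ‖gsVector α 1 s‖ r ‖gsVector α 2 s‖ p q
  rw [← hr, ← hpq, frenetFrame_zero_eq_unitTangent, ← R.deriv_eq_smul_unitTangent hs,
    ← frenetFrame_zero_eq_unitTangent, ← h, ← inner_cross3, ← frenetFrame_three,
    hα.norm_gsVector_one hI hsph hs, hα.norm_gsVector_two hI hsph hs, real_inner_comm] at e
  have : ‖deriv α s‖ ^ 6 * (intrinsicTorsion α s * intrinsicCurvature α s ^ 2) =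
      ‖deriv α s‖ ^ 6 * (curvature α 0 s ^ 2 * curvature α 1 s
        * inner ℝ (α s) (frenetFrame α s 3)) := by
    linear_combination e
  exact mul_left_cancel₀ (pow_ne_zero 6 hv) this

lemma inner_self_frenetFrame_zero (hs : s ∈ I) : inner ℝ (α s) (frenetFrame α s 0) = 0 := by
  rw [frenetFrame_zero_eq_unitTangent, real_inner_comm]
  exact (hα.isRegularSpherical hI hsph).inner_unitTangent_self hs

lemma deriv_eq_smul_frenetFrame (hs : s ∈ I) :
    deriv α s = ‖deriv α s‖ • frenetFrame α s 0 := by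
  rw [frenetFrame_zero_eq_unitTangent]
  exact (hα.isRegularSpherical hI hsph).deriv_eq_smul_unitTangent hs

/-- The derivative of ⟨α, e₁⟩ = 0, divided by the speed. -/
lemma curvature_mul_inner_one (hs : s ∈ I) :
    curvature α 0 s * inner ℝ (α s) (frenetFrame α s 1) = -1 := by
  have R := hα.isRegularSpherical hI hsph
  have hv := R.norm_deriv_ne_zero hs
  have h := inner_deriv_add_eq_zero hI hs (fun u hu => hα.inner_self_frenetFrame_zero hI hsph hu)
    (R.hasDerivAt hs) (hα.hasDerivAt_frenetFrame hI hs 0)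
  rw [hα.deriv_frenetFrame_zero_eq hI hsph hs, hα.deriv_eq_smul_frenetFrame hI hsph hs,
    real_inner_smul_right, real_inner_smul_left, (hα.isFrame hs).aa, ← hα.deriv_eq_smul_frenetFrame
    hI hsph hs] at h
  have : ‖deriv α s‖ * (curvature α 0 s * inner ℝ (α s) (frenetFrame α s 1) + 1) = 0 := by
    linear_combination h
  linarith [(mul_eq_zero.1 this).resolve_left hv]

/-- e₄ is orthogonal to α', α'' and α'''; differentiate ⟨e₁, e₄⟩ = 0 and ⟨α'', e₄⟩ = 0. -/
lemma inner_deriv_frenetFrame_three (hs : s ∈ I) :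
    inner ℝ (deriv (fun u => frenetFrame α u 3) s) (frenetFrame α s 0) = 0 ∧
    inner ℝ (deriv (fun u => frenetFrame α u 3) s) (frenetFrame α s 1) = 0 := by
  have R := hα.isRegularSpherical hI hsph
  have F := hα.isFrame hs
  have h1 := hα.inner_deriv_frenetFrame hI hs (i := 0) (j := 3) fun u hu => (hα.isFrame hu).ad
  rw [hα.deriv_frenetFrame_zero_eq hI hsph hs, real_inner_smul_left, F.bd, mul_zero, add_zero,
    real_inner_comm] at h1
  refine ⟨h1, ?_⟩
  have h0 : ∀ u ∈ I, inner ℝ (deriv (deriv α) u) (frenetFrame α u 3) = 0 := by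
    intro u hu
    obtain ⟨r, hr⟩ := hα.exists_deriv_two_eq hu
    rw [hr, inner_add_left, real_inner_smul_left, real_inner_smul_left, (hα.isFrame hu).bd,
      (hα.isFrame hu).ad]
    ring
  have h2 := inner_deriv_add_eq_zero hI hs h0 (R.hasDerivAt_deriv_two hs)
    (hα.hasDerivAt_frenetFrame hI hs 3)
  obtain ⟨r, hr⟩ := hα.exists_deriv_two_eq hs
  obtain ⟨p, q, hpq⟩ := hα.exists_deriv_three_eq hs
  rw [real_inner_comm] at h2
  rw [hr, hpq, inner_add_right, real_inner_smul_right, real_inner_smul_right, h1, inner_add_left,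
    inner_add_left, real_inner_smul_left, real_inner_smul_left, real_inner_smul_left, F.cd, F.bd,
    F.ad] at h2
  have hg := norm_ne_zero_iff.2 (hα.gsVector_ne_zero hs (j := 1) (by norm_num))
  simpa [hg] using h2

lemma hasDerivAt_inner_one (hs : s ∈ I) :
    HasDerivAt (fun u => inner ℝ (α u) (frenetFrame α u 1))
      (‖deriv α s‖ * curvature α 1 s * inner ℝ (α s) (frenetFrame α s 2)) s := by
  have R := hα.isRegularSpherical hI hsph
  have F := hα.isFrame hs
  have h1 := hα.inner_deriv_frenetFrame hI hs (i := 1) (j := 1) fun u hu => (hα.isFrame hu).bb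
  have h3 := hα.inner_deriv_frenetFrame hI hs (i := 1) (j := 3) fun u hu => (hα.isFrame hu).bd
  have h2 := hα.inner_deriv_frenet_succ hI hsph hs 1
  simp only [Fin.castSucc_one, Fin.succ_one_eq_two] at h2
  rw [real_inner_comm] at h1
  rw [real_inner_comm, (hα.inner_deriv_frenetFrame_three hI hsph hs).2] at h3
  refine ((R.hasDerivAt hs).inner ℝ (hα.hasDerivAt_frenetFrame hI hs 1)).congr_deriv ?_
  rw [F.inner_eq (α s), hα.inner_self_frenetFrame_zero hI hsph hs, h2,
    hα.deriv_eq_smul_frenetFrame hI hsph hs, real_inner_smul_left, F.ab,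
    ← hα.deriv_eq_smul_frenetFrame hI hsph hs,
    show inner ℝ (deriv (fun u => frenetFrame α u 1) s) (frenetFrame α s 1) = 0 by linarith,
    show inner ℝ (deriv (fun u => frenetFrame α u 1) s) (frenetFrame α s 3) = 0 by linarith]
  ring

lemma hasDerivAt_inner_three (hs : s ∈ I) :
    HasDerivAt (fun u => inner ℝ (α u) (frenetFrame α u 3))
      (-(‖deriv α s‖ * curvature α 2 s * inner ℝ (α s) (frenetFrame α s 2))) s := by
  have R := hα.isRegularSpherical hI hsph
  have F := hα.isFrame hs
  obtain ⟨d0, d1⟩ := hα.inner_deriv_frenetFrame_three hI hsph hs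
  have h3 := hα.inner_deriv_frenetFrame hI hs (i := 3) (j := 3) fun u hu => (hα.isFrame hu).dd
  have h2 := hα.inner_deriv_frenetFrame hI hs (i := 2) (j := 3) fun u hu => (hα.isFrame hu).cd
  have h := hα.inner_deriv_frenet_succ hI hsph hs 2
  rw [show (2 : Fin 3).castSucc = 2 from rfl, show (2 : Fin 3).succ = 3 from rfl] at h
  rw [real_inner_comm] at h3
  rw [h, real_inner_comm] at h2
  refine ((R.hasDerivAt hs).inner ℝ (hα.hasDerivAt_frenetFrame hI hs 3)).congr_deriv ?_
  rw [F.inner_eq (α s), d0, d1, hα.deriv_eq_smul_frenetFrame hI hsph hs, real_inner_smul_left,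
    F.ad, ← hα.deriv_eq_smul_frenetFrame hI hsph hs,
    show inner ℝ (deriv (fun u => frenetFrame α u 3) s) (frenetFrame α s 3) = 0 by linarith,
    show inner ℝ (deriv (fun u => frenetFrame α u 3) s) (frenetFrame α s 2)
      = -(‖deriv α s‖ * curvature α 2 s) by linarith]
  ring

lemma continuousOn_curvature_zero : ContinuousOn (curvature α 0) I := by
  have hc := (hα.isRegularSpherical hI hsph).continuousOn_intrinsicCurvature
  have h : ContinuousOn (fun s => √(intrinsicCurvature α s ^ 2 + 1)) I :=
    ((hc.pow 2).add continuousOn_const).sqrt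
  refine h.congr fun s hs => ?_
  beta_reduce
  rw [← hα.curvature_zero_sq hI hsph hs, Real.sqrt_sq (hα.curvature_zero_pos hI hsph hs).le]

/-- For a spherical curve with constant curvature ratios, the intrinsic torsion is a rational
function of the curvatures. -/
lemma exists_torsion_mul_curvature_sq_eq (hc : IsPreconnected I) {c₁ c₂ : ℝ}
    (h1 : ∀ s ∈ I, curvature α 1 s = c₁ * curvature α 0 s)
    (h2 : ∀ s ∈ I, curvature α 2 s = c₂ * curvature α 1 s) :
    ∃ C : ℝ, ∀ s ∈ I, intrinsicCurvature α s ≠ 0 →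
      intrinsicTorsion α s * intrinsicCurvature α s ^ 2 =
        c₁ * curvature α 0 s ^ 2 * (C * curvature α 0 s + c₂) := by
  -- The derivatives of ⟨α, e₄⟩ and ⟨α, e₂⟩ are -vk₃⟨α, e₃⟩ and vk₂⟨α, e₃⟩, so k₃ = c₂k₂ makes this
  -- combination constant.
  obtain ⟨C, hC⟩ := exists_eq_const_of_hasDerivAt_zero hI hc (f := fun s =>
    inner ℝ (α s) (frenetFrame α s 3) + c₂ * inner ℝ (α s) (frenetFrame α s 1)) fun s hs =>
    ((hα.hasDerivAt_inner_three hI hsph hs).add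
      ((hα.hasDerivAt_inner_one hI hsph hs).const_mul c₂)).congr_deriv (by rw [h2 s hs]; ring)
  refine ⟨C, fun s hs hκ => ?_⟩
  rw [hα.torsion_mul_curvature_sq hI hsph hs hκ, ← hC s hs, h1 s hs]
  linear_combination (-c₁ * curvature α 0 s ^ 2 * c₂) * hα.curvature_mul_inner_one hI hsph hs

end IsFrenetCurve

/-! ### Finitely many values of k₁, and connectedness. -/

/-- The first curvature of a spherical curve with constant curvature ratios whose torsion is affine
in the curvature solves this non-trivial polynomial equation. -/
lemma finite_solutions (c d m c₁ c₂ C : ℝ) (h : c ^ 2 + m ^ 2 ≠ 0) :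
    {x : ℝ | c ^ 2 * (x ^ 2 - 1) ^ 3 =
      (m * (x ^ 2 - 1) + d * (c₁ * x ^ 2 * (C * x + c₂))) ^ 2}.Finite := by
  let P : Polynomial ℝ := .C (c ^ 2) * (.X ^ 2 - 1) ^ 3
    - (.C m * (.X ^ 2 - 1) + .C d * (.C c₁ * .X ^ 2 * (.C C * .X + .C c₂))) ^ 2
  have hP : P ≠ 0 := by
    intro h0
    -- The value at 0 is -(c² + m²), whatever d, c₁, c₂ and C are.
    have := congrArg (Polynomial.eval 0) h0
    simp only [P, Polynomial.eval_sub, Polynomial.eval_add, Polynomial.eval_mul,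
      Polynomial.eval_pow, Polynomial.eval_C, Polynomial.eval_X, Polynomial.eval_one,
      Polynomial.eval_zero] at this
    exact h (by linear_combination -this)
  refine (P.rootSet_finite ℝ).subset fun x hx => ?_
  rw [Polynomial.mem_rootSet]
  refine ⟨hP, ?_⟩
  simp only [P, Polynomial.coe_aeval_eq_eval, Polynomial.eval_sub, Polynomial.eval_add,
    Polynomial.eval_mul, Polynomial.eval_pow, Polynomial.eval_C, Polynomial.eval_X,
    Polynomial.eval_one]
  exact sub_eq_zero.2 hx

namespace IsFrenetCurve

variable {I : Set ℝ} {α V : ℝ → E4} {c l c₁ c₂ C : ℝ}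

/-- On a ball where κ and τ do not vanish, either κ, and with it k₁ = √(κ² + 1), is constant, or k₁
takes values among the roots of a fixed polynomial and is constant by continuity. -/
lemma eventually_curvature_eq (hα : IsFrenetCurve I α) (hI : IsOpen I) (hsph : IsSpherical I α)
    (hC : ∀ s ∈ I, intrinsicCurvature α s ≠ 0 →
      intrinsicTorsion α s * intrinsicCurvature α s ^ 2 =
        c₁ * curvature α 0 s ^ 2 * (C * curvature α 0 s + c₂))
    (hV : IsInfinitesimallyKilling I α V)
    (hVt : ∀ s ∈ I, inner ℝ (V s) (unitTangent α s) = c) (hVl : ∀ s ∈ I, ‖V s‖ = l)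
    (hl : l ≠ 0) {s₀ : ℝ} (h₀ : s₀ ∈ I) (hκ₀ : intrinsicCurvature α s₀ ≠ 0)
    (hτ₀ : intrinsicTorsion α s₀ ≠ 0) :
    ∀ᶠ s in 𝓝 s₀, curvature α 0 s = curvature α 0 s₀ := by
  have R := hα.isRegularSpherical hI hsph
  have hU := R.isOpen_inter_curvature_ne_zero
  have hτc : ContinuousAt (intrinsicTorsion α) s₀ :=
    ((R.mono hU Set.inter_subset_left).differentiableAt_intrinsicTorsion
      (hα.contDiffOn.mono Set.inter_subset_left) (fun s hs => hs.2) ⟨h₀, hκ₀⟩).continuousAt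
  have hev := (hU.eventually_mem ⟨h₀, hκ₀⟩).and (hτc.eventually_ne hτ₀)
  obtain ⟨δ, hδ, hball⟩ := Metric.eventually_nhds_iff_ball.1 hev
  have hJI : Metric.ball s₀ δ ⊆ I := fun s hs => (hball s hs).1.1
  have hκ : ∀ s ∈ Metric.ball s₀ δ, intrinsicCurvature α s ≠ 0 := fun s hs => (hball s hs).1.2
  have hc : IsPreconnected (Metric.ball s₀ δ) := (convex_ball s₀ δ).isPreconnected
  have hmem : s₀ ∈ Metric.ball s₀ δ := Metric.mem_ball_self hδ
  suffices ∃ k, ∀ s ∈ Metric.ball s₀ δ, curvature α 0 s = k by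
    obtain ⟨k, hk⟩ := this
    exact eventually_of_mem (Metric.ball_mem_nhds s₀ hδ) fun s hs => by rw [hk s hs, hk s₀ hmem]
  rcases (R.mono Metric.isOpen_ball hJI).constant_curvature_or_affine_torsion
    (hα.contDiffOn.mono hJI) ⟨s₀, hmem⟩ hc hκ (fun s hs => (hball s hs).2) (hV.mono hJI)
    (fun s hs => hVt s (hJI hs)) (fun s hs => hVl s (hJI hs)) hl with ⟨k, hk⟩ | ⟨d, m, -, hcm, hd⟩
  · refine exists_eq_const_of_sq_eq hc ((hα.continuousOn_curvature_zero hI hsph).mono hJI)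
      (k := k ^ 2 + 1) fun s hs => ?_
    rw [hα.curvature_zero_sq hI hsph (hJI hs), hk s hs]
  · refine exists_eq_const_of_finite hc ((hα.continuousOn_curvature_zero hI hsph).mono hJI)
      (finite_solutions c d m c₁ c₂ C hcm) fun s hs => ?_
    have e1 := hα.curvature_zero_sq hI hsph (hJI hs)
    have e2 := hC s (hJI hs) (hκ s hs)
    have e3 := hd s hs
    rw [Set.mem_ofPred_eq, ← e2, show curvature α 0 s ^ 2 - 1 = intrinsicCurvature α s ^ 2 by
      linarith, ← mul_assoc, e3]
    ring

/-- The first curvature of a spherical helix with constant curvature ratios is constant. -/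
lemma exists_curvature_zero_eq (hα : IsFrenetCurve I α) (hI : IsOpen I) (hc : IsPreconnected I)
    (hsph : IsSpherical I α) (hc₁ : c₁ ≠ 0) (hc₂ : c₂ ≠ 0)
    (hC : ∀ s ∈ I, intrinsicCurvature α s ≠ 0 →
      intrinsicTorsion α s * intrinsicCurvature α s ^ 2 =
        c₁ * curvature α 0 s ^ 2 * (C * curvature α 0 s + c₂))
    (hV : IsInfinitesimallyKilling I α V)
    (hVt : ∀ s ∈ I, inner ℝ (V s) (unitTangent α s) = c) (hVl : ∀ s ∈ I, ‖V s‖ = l)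
    (hl : l ≠ 0) : ∃ k, ∀ s ∈ I, curvature α 0 s = k := by
  have hk := hα.continuousOn_curvature_zero hI hsph
  -- κ = 0 forces k₁ = 1, and τ = 0 with κ ≠ 0 forces Ck₁ = -c₂. If C = 0 the quotient reads 0,
  -- harmlessly: then τ cannot vanish where κ ≠ 0, as c₂ ≠ 0.
  by_cases hB : ∀ s ∈ I, curvature α 0 s ∈ ({1, -c₂ / C} : Set ℝ)
  · exact exists_eq_const_of_finite hc hk (Set.toFinite _) hB
  push Not at hB
  obtain ⟨s₀, h₀, hs₀⟩ := hB
  simp only [Set.mem_insert_iff, Set.mem_singleton_iff, not_or] at hs₀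
  obtain ⟨hne1, hne2⟩ := hs₀
  refine ⟨curvature α 0 s₀, ?_⟩
  -- Every point of this level set has κ and τ nonzero, since its value of k₁ is not exceptional;
  -- hence k₁ is locally constant there.
  have hopen : IsOpen (I ∩ {s | curvature α 0 s = curvature α 0 s₀}) := by
    rw [isOpen_iff_mem_nhds]
    rintro s ⟨hs, hsk⟩
    have hpos := hα.curvature_zero_pos hI hsph hs
    have hκ : intrinsicCurvature α s ≠ 0 := by
      intro h
      have e := hα.curvature_zero_sq hI hsph hs
      rw [h] at e
      exact hne1 (hsk ▸ (pow_eq_one_iff_of_nonneg hpos.le two_ne_zero).1 (by linarith))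
    have hτ : intrinsicTorsion α s ≠ 0 := by
      intro h
      have e := hC s hs hκ
      rw [h, zero_mul, hsk] at e
      rw [hsk] at hpos
      have e' := (mul_eq_zero.1 e.symm).resolve_left (mul_ne_zero hc₁ (pow_ne_zero 2 hpos.ne'))
      have hC0 : C ≠ 0 := by
        rintro rfl
        exact hc₂ (by linarith)
      exact hne2 (by rw [eq_div_iff hC0]; linarith)
    have hev := hα.eventually_curvature_eq hI hsph hC hV hVt hVl hl hs hκ hτ
    filter_upwards [hI.mem_nhds hs, hev] with u hu hue
    exact ⟨hu, hue.trans hsk⟩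
  have hopen' : IsOpen (I ∩ curvature α 0 ⁻¹' {curvature α 0 s₀}ᶜ) :=
    hk.isOpen_inter_preimage hI isOpen_compl_singleton
  have hsub := IsPreconnected.subset_left_of_subset_union hopen hopen'
    (Set.disjoint_left.2 fun s hs hs' => hs'.2 hs.2)
    (fun s hs => by
      by_cases h : curvature α 0 s = curvature α 0 s₀
      · exact Or.inl ⟨hs, h⟩
      · exact Or.inr ⟨hs, h⟩) ⟨s₀, h₀, h₀, rfl⟩ hc
  exact fun s hs => (hsub hs).2

end IsFrenetCurve

end

/-- A twisted curve with constant curvature ratios on the unit sphere of `ℝ⁴` that is also a general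
helix of `S³` has constant curvatures. -/
theorem mainTheorem5 (I : Set ℝ) (hIo : IsOpen I) (hIc : I.OrdConnected) (α : ℝ → E4)
    (hα : IsFrenetCurve I α) (hsph : IsSpherical I α) (htw : IsTwisted I α)
    (hccr : IsCCR I α) (hhelix : IsGeneralHelix I α) :
    HasConstantCurvatures I α := by
  rcases I.eq_empty_or_nonempty with rfl | ⟨s₀, h₀⟩
  · exact fun _ => ⟨0, by simp⟩
  have hc : IsPreconnected I := hIc.isPreconnected
  have R := hα.isRegularSpherical hIo hsph
  obtain ⟨c₁, h1⟩ := hccr 0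
  obtain ⟨c₂, h2⟩ := hccr 1
  simp only [Fin.succ_zero_eq_one, Fin.castSucc_zero] at h1
  simp only [Fin.succ_one_eq_two, Fin.castSucc_one] at h2
  have k0 := fun s hs => (hα.curvature_zero_pos hIo hsph (s := s) hs).ne'
  have k1 := fun s hs => hα.curvature_one_ne_zero hIo hsph (s := s) hs
  have hc₁ : c₁ ≠ 0 := h1 s₀ h₀ ▸ div_ne_zero (k1 s₀ h₀) (k0 s₀ h₀)
  have hc₂ : c₂ ≠ 0 := h2 s₀ h₀ ▸ div_ne_zero (htw s₀ h₀) (k1 s₀ h₀)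
  have h1' : ∀ s ∈ I, curvature α 1 s = c₁ * curvature α 0 s := fun s hs =>
    (div_eq_iff (k0 s hs)).1 (h1 s hs)
  have h2' : ∀ s ∈ I, curvature α 2 s = c₂ * curvature α 1 s := fun s hs =>
    (div_eq_iff (k1 s hs)).1 (h2 s hs)
  obtain ⟨C, hC⟩ := hα.exists_torsion_mul_curvature_sq_eq hIo hsph hc h1' h2'
  obtain ⟨V, l, θ, hV, hl, hVs⟩ := hhelix
  -- Constant length and constant angle enter through the constant c = l cos θ.
  have hVt : ∀ s ∈ I, inner ℝ (V s) (unitTangent α s) = Real.cos θ * l := by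
    intro s hs
    have hv := R.norm_deriv_ne_zero hs
    have e := InnerProductGeometry.cos_angle_mul_norm_mul_norm (V s) (deriv α s)
    rw [(hVs s hs).1, (hVs s hs).2] at e
    rw [unitTangent, real_inner_smul_right, ← e]
    field_simp
  obtain ⟨k, hk⟩ := hα.exists_curvature_zero_eq hIo hc hsph hc₁ hc₂ hC
    (R.isInfinitesimallyKilling hV) hVt (fun s hs => (hVs s hs).1) hl
  intro i
  fin_cases i
  · exact ⟨k, hk⟩
  · exact ⟨c₁ * k, fun s hs => (h1' s hs).trans (by rw [hk s hs])⟩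
  · exact ⟨c₂ * (c₁ * k), fun s hs => (h2' s hs).trans (by rw [h1' s hs, hk s hs])⟩
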